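/- Let $V$ be a Euclidean space of dimension $n\ge 1$ with scalar product $(\cdot,\cdot)$, and let $\Phi$ be a root system spanning $V$: a finite set of nonzero vectors, stable under the reflections $s_\beta$ ($\beta\in\Phi$), with $\Phi\cap\mathbb{R}\beta=\{\pm\beta\}$ for $\beta\in\Phi$ ($\Phi$ need not be irreducible or crystallographic). Let $W$ be the finite group generated by the $s_\beta$, let $\alpha_1,\dots,\alpha_n\in\Phi$ be a basis of simple roots, let $\delta$ be the semisum of the positive roots, and let $\{x\in V\mid (x,\alpha_i)>0 \text{ for all } i\}$ be the open fundamental chamber. Let $\mathcal{C}_\Phi$ be the set of all subspaces spanned by a nonempty set of roots. A building set is a set $\mathcal{G}\subseteq\mathcal{C}_\Phi$ that contains all lines $\mathbb{R}\beta$ ($\beta\in\Phi$) and is such that every $C\in\mathcal{C}_\Phi$ is the direct sum of the maximal elements of $\mathcal{G}$ contained in $C$. Let $\mathcal{G}$ be a $W$-invariant building set with $V\in\mathcal{G}$, and let $\mathcal{G}_{fund}$ be the set of the $A\in\mathcal{G}$ that are spanned by some set of simple roots. A subset $\mathcal{S}\subseteq\mathcal{G}_{fund}$ is nested if the sum of two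 or more distinct pairwise non comparable elements of $\mathcal{S}$ never belongs to $\mathcal{G}_{fund}$; the nested set complex $\mathcal{N}(\mathcal{G}_{fund})$ is the poset, ordered by inclusion, of the nested sets that contain $V$. For $A\in\mathcal{G}_{fund}$ let $\pi_A$ be the orthogonal projection of $\delta$ to $A$; put $\delta_A=\delta-\pi_A$ if $A\neq V$, and $\delta_V=\delta$. For $B\subsetneq A$ in $\mathcal{G}_{fund}$ let $R^A_B=a_A/b_B$, where $a_A$ is the maximum coefficient of $\pi_A$ with respect to the simple roots lying in $A$ and $b_B$ is the minimum coefficient of $\pi_B$ with respect to the simple roots lying in $B$. Let $R^i_j$ be the maximum of the $R^A_B$ over all $B\subsetneq A$ in $\mathcal{G}_{fund}$ with $\dim B=j$ and $\dim A=i$, and $R^i_j=1$ if there is no such pair. Let $0<\epsilon_1<\epsilon_2<\dots<\epsilon_n=a$ be a suitable list, i.e. $\epsilon_i>2R^i_{i-1}\epsilon_{i-1}$ for $i=2,\dots,n$. Put $$H_V=\{x\in V\mid (x,\delta)=a\},$$ and, for $A\in\mathcal{G}_{fund}-\{V\}$, $$H_A=\{x\in V\mid (x,\delta_A)=a-\epsilon_{\dim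 A}\},\qquad HS_A=\{x\in V\mid (x,\delta_A)\le a-\epsilon_{\dim A}\},$$ so that $HS_A$ is the closed half-space bounded by $H_A$ that contains the origin. Then: 1. The intersection $P$ of $H_V$ with all the half-spaces $HS_A$, $A\in\mathcal{G}_{fund}-\{V\}$, is a realization of the nestohedron $P_{\mathcal{G}_{fund}}$: it is a polytope, and the poset of its nonempty faces, ordered by reverse inclusion, is isomorphic to $\mathcal{N}(\mathcal{G}_{fund})$. 2. $P$ is contained in the open fundamental chamber. 3. Every maximal (with respect to inclusion) nested set $\mathcal{S}$ of $\mathcal{G}_{fund}$ contains $V$ and has $n$ elements, the vectors $\delta_A$ ($A\in\mathcal{S}$) are linearly independent, and hence $\bigcap_{A\in\mathcal{S}}H_A$ is a single point $v_{\mathcal{S}}$. The vertices of $P$ are exactly the points $v_{\mathcal{S}}$, where $\mathcal{S}$ ranges over the maximal nested sets of $\mathcal{G}_{fund}$. -/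

import Mathlib

open scoped InnerProductSpace

noncomputable section

namespace Permutonestohedron

/-! ### Building sets and nested sets of subspaces -/

section Building

variable {V : Type*} [AddCommGroup V] [Module ℝ V]

/-- The closure under sum of a set of subspaces: all sums of nonempty subfamilies. -/
def sumClosure (𝒜 : Set (Submodule ℝ V)) : Set (Submodule ℝ V) :=
  {C | ∃ T : Set (Submodule ℝ V), T ⊆ 𝒜 ∧ T.Nonempty ∧ sSup T = C}

/-- The maximal elements of `G` among those contained in `C`. -/
def maximalBelow (G : Set (Submodule ℝ V)) (C : Submodule ℝ V) : Set (Submodule ℝ V) :=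
  {U | Maximal (fun U => U ∈ G ∧ U ≤ C) U}

/-- `G` is a building set associated to the line arrangement `𝒜`: it consists of sums of lines
of `𝒜`, contains `𝒜`, and every sum `C` of lines of `𝒜` is the direct sum of the maximal elements
of `G` contained in `C`. -/
structure IsBuildingSet (𝒜 G : Set (Submodule ℝ V)) : Prop where
  subset_sumClosure : G ⊆ sumClosure 𝒜
  lines_subset : 𝒜 ⊆ G
  independent : ∀ C ∈ sumClosure 𝒜, sSupIndep (maximalBelow G C)
  sum_eq : ∀ C ∈ sumClosure 𝒜, sSup (maximalBelow G C) = C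

/-- `S` is a `G`-nested set: `S ⊆ G`, and the sum of two or more pairwise non comparable elements
of `S` never belongs to `G`. -/
def IsNested (G S : Set (Submodule ℝ V)) : Prop :=
  S ⊆ G ∧ ∀ T : Set (Submodule ℝ V), T ⊆ S → T.Nontrivial → IsAntichain (· ≤ ·) T → sSup T ∉ G

/-- The nested set complex: the poset (by inclusion) of the nested sets that contain `V`. -/
abbrev NestedSetComplex (G : Set (Submodule ℝ V)) : Type _ :=
  {S : Set (Submodule ℝ V) // IsNested G S ∧ (⊤ : Submodule ℝ V) ∈ S}

/-- `S` is a maximal nested set. -/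
def IsMaximalNested (G S : Set (Submodule ℝ V)) : Prop :=
  Maximal (IsNested G) S

end Building

/-! ### Polytopes and nestohedra -/

section Polytopes

variable {V : Type*} [NormedAddCommGroup V] [InnerProductSpace ℝ V]

/-- A polytope is the convex hull of a finite set. -/
def IsPolytope (P : Set V) : Prop :=
  ∃ t : Set V, t.Finite ∧ P = convexHull ℝ t

/-- The poset (by inclusion) of the nonempty faces of `P`: the nonempty subsets of `P` where
some linear functional attains its maximum over `P`. The polytope `P` is itself a face. -/
abbrev FacePoset (P : Set V) : Type _ :=
  {F : Set V // IsExposed ℝ P F ∧ F.Nonempty}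

/-- `P` is a linear realization of the nestohedron of `G`: it is a polytope whose face poset,
ordered by reverse inclusion, is isomorphic to the nested set complex of `G`. -/
def IsNestohedron (G : Set (Submodule ℝ V)) (P : Set V) : Prop :=
  IsPolytope P ∧ Nonempty ((FacePoset P)ᵒᵈ ≃o NestedSetComplex G)

end Polytopes

/-! ### Root systems -/

section Roots

variable {V : Type*} [NormedAddCommGroup V] [InnerProductSpace ℝ V] [FiniteDimensional ℝ V]

/-- The orthogonal reflection `s_β` in the hyperplane orthogonal to `β`. -/
def rootReflection (β : V) : V ≃ₗᵢ[ℝ] V := (Submodule.span ℝ {β})ᗮ.reflection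

/-- A (reduced, not necessarily crystallographic) root system spanning the Euclidean space `V`. -/
structure IsRootSystem (Φ : Finset V) : Prop where
  zero_notMem : (0 : V) ∉ Φ
  span_eq_top : Submodule.span ℝ (Φ : Set V) = ⊤
  reflection_mem : ∀ β ∈ Φ, ∀ γ ∈ Φ, rootReflection β γ ∈ Φ
  reduced : ∀ β ∈ Φ, ∀ c : ℝ, c • β ∈ Φ → c = 1 ∨ c = -1

/-- The finite Coxeter group `W` generated by the reflections `s_β`, `β ∈ Φ`. -/
def coxeterGroup (Φ : Finset V) : Subgroup (V ≃ₗᵢ[ℝ] V) :=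
  Subgroup.closure (rootReflection '' (Φ : Set V))

/-- The arrangement of the lines spanned by the roots. -/
def rootLines (Φ : Finset V) : Set (Submodule ℝ V) :=
  {L | ∃ β ∈ Φ, L = Submodule.span ℝ {β}}

/-- `G` is invariant under `W`. -/
def IsInvariant (Φ : Finset V) (G : Set (Submodule ℝ V)) : Prop :=
  ∀ w ∈ coxeterGroup Φ, ∀ A ∈ G, A.map (w.toLinearEquiv : V →ₗ[ℝ] V) ∈ G

variable {n : ℕ}

/-- `α₁, …, αₙ` is a basis of simple roots of `Φ`: a basis of `V` made of roots such that the
coordinates of each root are all nonnegative or all nonpositive. -/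
structure IsSimpleBasis (Φ : Finset V) (α : Module.Basis (Fin n) ℝ V) : Prop where
  mem : ∀ i, α i ∈ Φ
  sign : ∀ β ∈ Φ, (∀ i, 0 ≤ α.repr β i) ∨ (∀ i, α.repr β i ≤ 0)

/-- The open fundamental chamber. -/
def openChamber (α : Module.Basis (Fin n) ℝ V) : Set V :=
  {x | ∀ i, 0 < ⟪x, α i⟫_ℝ}

open Classical in
/-- `δ`, the semisum of the positive roots. -/
def delta (Φ : Finset V) (α : Module.Basis (Fin n) ℝ V) : V :=
  (1 / 2 : ℝ) • ∑ β ∈ Φ.filter (fun β => ∀ i, 0 ≤ α.repr β i), β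

/-- `G_fund`: the elements of `G` that are spanned by some set of simple roots. -/
def fund (α : Module.Basis (Fin n) ℝ V) (G : Set (Submodule ℝ V)) : Set (Submodule ℝ V) :=
  {A | A ∈ G ∧ ∃ I : Set (Fin n), A = Submodule.span ℝ (α '' I)}

/-- `π_A`, the orthogonal projection of `δ` to `A`; in particular `π_V = δ`. -/
def piVec (Φ : Finset V) (α : Module.Basis (Fin n) ℝ V) (A : Submodule ℝ V) : V :=
  A.starProjection (delta Φ α)

open Classical in
/-- `δ_A`, the orthogonal projection of `δ` to `Aᗮ` if `A ≠ V`, while `δ_V = δ`. -/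
def deltaVec (Φ : Finset V) (α : Module.Basis (Fin n) ℝ V) (A : Submodule ℝ V) : V :=
  if A = ⊤ then delta Φ α else Aᗮ.starProjection (delta Φ α)

/-- The set of the coefficients of `π_A` as a combination of the simple roots lying in `A`. -/
def piCoeffs (Φ : Finset V) (α : Module.Basis (Fin n) ℝ V) (A : Submodule ℝ V) : Set ℝ :=
  {c | ∃ i, α i ∈ A ∧ c = α.repr (piVec Φ α A) i}

/-- `R^A_B`: the maximum coefficient of `π_A` divided by the minimum coefficient of `π_B`. -/
def ratio (Φ : Finset V) (α : Module.Basis (Fin n) ℝ V) (A B : Submodule ℝ V) : ℝ :=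
  sSup (piCoeffs Φ α A) / sInf (piCoeffs Φ α B)

/-- The set of all the `R^A_B` with `B ⊂ A` in `G_fund` of dimensions `j` and `i`. -/
def ratios (Φ : Finset V) (α : Module.Basis (Fin n) ℝ V) (G : Set (Submodule ℝ V)) (i j : ℕ) :
    Set ℝ :=
  {r | ∃ A ∈ fund α G, ∃ B ∈ fund α G, B < A ∧ Module.finrank ℝ A = i ∧
    Module.finrank ℝ B = j ∧ r = ratio Φ α A B}

open Classical in
/-- `R^i_j`: the maximum of all the `R^A_B` with `B ⊂ A` in `G_fund` of dimensions `j` and `i`.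
If there is no such pair, the maximum is read as `1`, the least value that any `R^A_B` with
`B ⊂ A` can take. -/
def maxRatio (Φ : Finset V) (α : Module.Basis (Fin n) ℝ V) (G : Set (Submodule ℝ V))
    (i j : ℕ) : ℝ :=
  if (ratios Φ α G i j).Nonempty then sSup (ratios Φ α G i j) else 1

/-- `ε₁ < ε₂ < ⋯ < εₙ` is a suitable list of positive real numbers (only the values of `ε` at
`1, …, n` matter). -/
structure IsSuitable (Φ : Finset V) (α : Module.Basis (Fin n) ℝ V) (G : Set (Submodule ℝ V))
    (ε : ℕ → ℝ) : Prop where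
  pos : ∀ i, 1 ≤ i → i ≤ n → 0 < ε i
  lt : ∀ i, 2 ≤ i → i ≤ n → ε (i - 1) < ε i
  suitable : ∀ i, 2 ≤ i → i ≤ n → 2 * maxRatio Φ α G i (i - 1) * ε (i - 1) < ε i

open Classical in
/-- The right hand side of the equation of `H_A`: it is `a = εₙ` if `A = V`, and
`a - ε_{dim A}` otherwise. -/
def level (n : ℕ) (ε : ℕ → ℝ) (A : Submodule ℝ V) : ℝ :=
  if A = ⊤ then ε n else ε n - ε (Module.finrank ℝ A)

/-- The hyperplane `H_A`; in particular `H_V = {x | (x, δ) = a}`. -/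
def hyperplane (Φ : Finset V) (α : Module.Basis (Fin n) ℝ V) (ε : ℕ → ℝ) (A : Submodule ℝ V) :
    Set V :=
  {x | ⟪x, deltaVec Φ α A⟫_ℝ = level n ε A}

/-- The closed half-space `HS_A` bounded by `H_A` that contains the origin. -/
def halfSpace (Φ : Finset V) (α : Module.Basis (Fin n) ℝ V) (ε : ℕ → ℝ) (A : Submodule ℝ V) :
    Set V :=
  {x | ⟪x, deltaVec Φ α A⟫_ℝ ≤ level n ε A}

/-- The intersection of `H_V` with all the half-spaces `HS_A`, `A ∈ G_fund - {V}`. -/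
def nestohedron (Φ : Finset V) (α : Module.Basis (Fin n) ℝ V) (G : Set (Submodule ℝ V))
    (ε : ℕ → ℝ) : Set V :=
  hyperplane Φ α ε ⊤ ∩ ⋂ A ∈ fund α G \ {⊤}, halfSpace Φ α ε A

/-- `x` is the vector `v_S`: `S` is a set of `n` subspaces of `G_fund` containing `V`, the vectors
`δ_A`, `A ∈ S`, are linearly independent, and `x` is the only common point of the hyperplanes
`H_A`, `A ∈ S`. -/
structure IsVertexVector (Φ : Finset V) (α : Module.Basis (Fin n) ℝ V) (G : Set (Submodule ℝ V))
    (ε : ℕ → ℝ) (S : Set (Submodule ℝ V)) (x : V) : Prop where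
  subset_fund : S ⊆ fund α G
  top_mem : (⊤ : Submodule ℝ V) ∈ S
  card_eq : S.encard = n
  linearIndependent : LinearIndependent ℝ (fun A : S => deltaVec Φ α (A : Submodule ℝ V))
  inter_eq : (⋂ A ∈ S, hyperplane Φ α ε A) = {x}

end Roots

end Permutonestohedron

end

/-!
The proof is organised around active sets: a point `x` of the nestohedron `P` is labelled by the set
of those `A ∈ G_fund` for which `x` lies on `H_A`. Two facts are shown: the active set of every point
of `P` is nested (`isNested_active`), and every nested set containing `V` is the active set of some
point of `P` (`exists_active_eq`). The rest is general convexity. A nonempty face of a polyhedron is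
determined by the active set of a relative interior point, which gives the isomorphism of posets
(`facePosetIso`); vertices are the points with maximal active sets; and at a vertex there is no room
to move, so that the vectors `δ_A` for `A` in a maximal nested set span `V`
(`isVertexVector_of_active`). There are at most `n` of them, since each member of a nested set owns
some simple root that lies in none of its smaller members (`IsCoordBuilding.exists_owner`), hence they form a basis.

On `H_V`, the half-space `HS_A` is given by `(x, π_A) ≥ ε_{dim A}`, that is, by a lower bound for a
combination of the numbers `y_i = (x, α_i)` with `α_i ∈ A` whose coefficients are those of `π_A`.
These coefficients are positive, because `δ` has positive scalar products with the simple roots and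
distinct simple roots have nonpositive ones. For the lines `ℝα_i` this already puts `P` in the open
chamber.

The suitability of the list `ε` enters through `repr_piVec_mul_lt`: after rescaling the inequality of
each `A` such that its right hand side becomes `2 ^ dim A`, its coefficients strictly decrease as `A`
grows. A telescoping argument reduces this to the case of codimension one: if a simple root is not
orthogonal to `B ∈ G_fund`, then it spans together with `B` an element of `G_fund`
(`sup_span_simple_mem_fund`), and adding orthogonal simple roots does not change the coefficients.

Now let `A ∈ G_fund` be the direct sum of at least two `B_j ∈ G_fund`. If all `B_j` are active at
`x`, then the weighted sum of `A` at `x` is less than `∑ 2 ^ dim B_j ≤ 2 ^ dim A`, which contradicts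
`x ∈ P`. If two active members of `G_fund` share a simple root without being comparable, then their
sum lies in `G_fund`, and the same estimate applies. Thus active sets are nested
(`isNested_of_weightedSum_eq`). Conversely, for a nested set `S` one solves the equations of its members by recursion on the dimension, distributing the amount
missing for `A` evenly among the simple roots owned by `A`; that amount is at least half of
`2 ^ dim A`, and a count of the simple roots missing in `C` shows that the inequalities of the
other `C ∈ G_fund` hold strictly (`exists_weightedSum_eq_iff`).
-/

noncomputable section

namespace Permutonestohedron

/-! ### Face posets of polyhedra -/

section Polyhedra

open Set Filter Topology

variable {K E : Type*} [NormedAddCommGroup E] [InnerProductSpace ℝ E]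

/-- The polyhedron cut out by the inequalities `b A ≤ f A x`, `A ∈ F`, the one with index `t`
being required to be an equality. -/
def polyhedron (F : Set K) (t : K) (f : K → StrongDual ℝ E) (b : K → ℝ) : Set E :=
  {x | f t x = b t ∧ ∀ A ∈ F, b A ≤ f A x}

/-- The indices of the inequalities that are equalities at `x`. -/
def active (F : Set K) (f : K → StrongDual ℝ E) (b : K → ℝ) (x : E) : Set K :=
  {A | A ∈ F ∧ f A x = b A}

/-- The points of the polyhedron at which all the inequalities indexed by `S` are equalities. -/
def faceOf (F : Set K) (t : K) (f : K → StrongDual ℝ E) (b : K → ℝ) (S : Set K) : Set E :=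
  {x | x ∈ polyhedron F t f b ∧ S ⊆ active F f b x}

variable {F : Set K} {t : K} {f : K → StrongDual ℝ E} {b : K → ℝ} {x z u : E} {S : Set K}

lemma active_subset : active F f b x ⊆ F := fun _ hA => hA.1

lemma mem_active_top (ht : t ∈ F) (hx : x ∈ polyhedron F t f b) : t ∈ active F f b x :=
  ⟨ht, hx.1⟩

lemma convex_polyhedron : Convex ℝ (polyhedron F t f b) := by
  intro x hx y hy r s hr hs hrs
  refine ⟨?_, fun A hA => ?_⟩
  · simp only [map_add, map_smul, smul_eq_mul, hx.1, hy.1]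
    rw [← add_mul, hrs, one_mul]
  · simp only [map_add, map_smul, smul_eq_mul]
    calc b A = r * b A + s * b A := by rw [← add_mul, hrs, one_mul]
      _ ≤ _ := add_le_add (mul_le_mul_of_nonneg_left (hx.2 A hA) hr)
        (mul_le_mul_of_nonneg_left (hy.2 A hA) hs)

lemma isClosed_polyhedron : IsClosed (polyhedron F t f b) := by
  have : polyhedron F t f b = {x | f t x = b t} ∩ ⋂ A ∈ F, {x | b A ≤ f A x} := by
    ext x; simp [polyhedron]
  rw [this]
  exact (isClosed_eq (f t).continuous continuous_const).inter
    (isClosed_biInter fun A _ => isClosed_le continuous_const (f A).continuous)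

/-- An inequality active at a proper convex combination of two points of the polyhedron is active
at both points. -/
lemma active_combo_subset (hx : x ∈ polyhedron F t f b) (hz : z ∈ polyhedron F t f b)
    {r s : ℝ} (hr : 0 < r) (hs : 0 < s) (hrs : r + s = 1) :
    active F f b (r • x + s • z) ⊆ active F f b x ∩ active F f b z := by
  rintro A ⟨hA, h⟩
  simp only [map_add, map_smul, smul_eq_mul] at h
  have h1 := hx.2 A hA
  have h2 := hz.2 A hA
  have hb : r * b A + s * b A = b A := by rw [← add_mul, hrs, one_mul]
  have h3 := mul_le_mul_of_nonneg_left h1 hr.le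
  have h4 := mul_le_mul_of_nonneg_left h2 hs.le
  refine ⟨⟨hA, ?_⟩, ⟨hA, ?_⟩⟩
  · exact mul_left_cancel₀ hr.ne' (by linarith)
  · exact mul_left_cancel₀ hs.ne' (by linarith)

/-- From a point of the polyhedron one can move a little in every direction along which the active
inequalities stay equalities. -/
lemma exists_add_smul_mem (hF : F.Finite) (ht : t ∈ F) (hx : x ∈ polyhedron F t f b)
    (hu : ∀ A ∈ active F f b x, f A u = 0) :
    ∃ r : ℝ, 0 < r ∧ x + r • u ∈ polyhedron F t f b := by
  have h : ∀ᶠ r : ℝ in 𝓝[>] 0, ∀ A ∈ F, b A ≤ f A (x + r • u) := by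
    rw [eventually_all_finite hF]
    intro A hA
    rcases (hx.2 A hA).eq_or_lt with h | h
    · refine Eventually.of_forall fun r => ?_
      rw [map_add, map_smul, hu A ⟨hA, h.symm⟩, smul_zero, add_zero]
      exact h.le
    · have hc : Tendsto (fun r : ℝ => f A (x + r • u)) (𝓝[>] 0) (𝓝 (f A x)) := by
        have : Continuous (fun r : ℝ => f A (x + r • u)) := by fun_prop
        have h0 := (this.tendsto 0).mono_left (nhdsWithin_le_nhds (s := Ioi (0 : ℝ)))
        simpa using h0
      exact (hc.eventually (lt_mem_nhds h)).mono fun r hr => hr.le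
  obtain ⟨r, hr, hr0⟩ := (h.and self_mem_nhdsWithin).exists
  refine ⟨r, hr0, ?_, hr⟩
  rw [map_add, map_smul, hu t (mem_active_top ht hx), smul_zero, add_zero, hx.1]

/-- If the inequalities active at `x` are also active at `z`, then `x` is interior to a segment of
the polyhedron that ends at `z`. -/
lemma exists_mem_openSegment (hF : F.Finite) (ht : t ∈ F) (hx : x ∈ polyhedron F t f b)
    (hxz : active F f b x ⊆ active F f b z) :
    ∃ r : ℝ, 0 < r ∧ x + r • (x - z) ∈ polyhedron F t f b ∧
      x ∈ openSegment ℝ z (x + r • (x - z)) := by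
  obtain ⟨r, hr, h⟩ := exists_add_smul_mem (u := x - z) hF ht hx fun A hA => by
    rw [map_sub, hA.2, (hxz hA).2, sub_self]
  refine ⟨r, hr, h, r / (1 + r), 1 / (1 + r), by positivity, by positivity, by field_simp; ring, ?_⟩
  have h1 : (1 + r) ≠ 0 := by positivity
  rw [← smul_right_injective E h1 |>.eq_iff]
  simp only [smul_add, smul_smul]
  field_simp
  module

lemma eq_of_mem_extremePoints (hF : F.Finite) (ht : t ∈ F)
    (hx : x ∈ (polyhedron F t f b).extremePoints ℝ) (hz : z ∈ polyhedron F t f b)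
    (hxz : active F f b x ⊆ active F f b z) : z = x := by
  obtain ⟨r, -, h, hs⟩ := exists_mem_openSegment hF ht hx.1 hxz
  exact hx.2 hz h hs

lemma isExposed_faceOf (hF : F.Finite) (hS : S ⊆ F) (hne : (faceOf F t f b S).Nonempty) :
    IsExposed ℝ (polyhedron F t f b) (faceOf F t f b S) := by
  intro _
  obtain ⟨x₀, hx₀, hS₀⟩ := hne
  set T := (hF.subset hS).toFinset with hT
  have key : ∀ x ∈ polyhedron F t f b, ∀ A ∈ T, b A ≤ f A x := fun x hx A hA =>
    hx.2 A (hS (by simpa [hT] using hA))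
  refine ⟨-∑ A ∈ T, f A, Set.ext fun x => ⟨?_, ?_⟩⟩
  · rintro ⟨hx, hxS⟩
    refine ⟨hx, fun y hy => ?_⟩
    simp only [neg_apply, sum_apply, neg_le_neg_iff]
    refine Finset.sum_le_sum fun A hA => ?_
    rw [(hxS (by simpa [hT] using hA)).2]
    exact key y hy A hA
  · rintro ⟨hx, hmax⟩
    refine ⟨hx, fun A hA => ⟨hS hA, ?_⟩⟩
    have h := hmax x₀ hx₀
    simp only [neg_apply, sum_apply, neg_le_neg_iff] at h
    have h0 : ∑ A ∈ T, f A x₀ = ∑ A ∈ T, b A :=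
      Finset.sum_congr rfl fun A hA => (hS₀ (by simpa [hT] using hA)).2
    rw [h0] at h
    have h1 := (Finset.sum_eq_sum_iff_of_le (key x hx)).1
      (le_antisymm (Finset.sum_le_sum (key x hx)) h)
    exact (h1 A (by simpa [hT] using hA)).symm

/-- A nonempty face is determined by the inequalities that are active at all its points: it has a
relative interior point `x`, and it consists of all points at which the inequalities active at `x`
are active. -/
lemma exists_eq_faceOf (hF : F.Finite) (ht : t ∈ F) {B : Set E}
    (hB : IsExposed ℝ (polyhedron F t f b) B) (hne : B.Nonempty) :
    ∃ x ∈ polyhedron F t f b, B = faceOf F t f b (active F f b x) := by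
  set g : E → ℕ := fun x => (active F f b x).ncard
  set x := Function.argminOn g B hne
  have hxB : x ∈ B := Function.argminOn_mem g B hne
  have hfin : ∀ y, (active F f b y).Finite := fun y => hF.subset active_subset
  -- A point with the fewest active inequalities is a relative interior point.
  have hmin : ∀ z ∈ B, active F f b x ⊆ active F f b z := by
    intro z hz
    have hm : (1 / 2 : ℝ) • x + (1 / 2 : ℝ) • z ∈ B :=
      (hB.convex convex_polyhedron) hxB hz (by norm_num) (by norm_num) (by norm_num)
    have hsub := active_combo_subset (hB.subset hxB) (hB.subset hz) (r := 1 / 2) (s := 1 / 2)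
      (by norm_num) (by norm_num) (by norm_num)
    have hle : g x ≤ g ((1 / 2 : ℝ) • x + (1 / 2 : ℝ) • z) := Function.argminOn_le g B hm
    rw [← Set.eq_of_subset_of_ncard_le (hsub.trans inter_subset_left) hle (hfin x)]
    exact hsub.trans inter_subset_right
  refine ⟨x, hB.subset hxB, Set.Subset.antisymm (fun z hz => ⟨hB.subset hz, hmin z hz⟩) ?_⟩
  rintro z ⟨hz, hxz⟩
  obtain ⟨r, -, h, hs⟩ := exists_mem_openSegment hF ht (hB.subset hxB) hxz
  exact hB.isExtreme.left_mem_of_mem_openSegment hz h hxB hs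

/-- If the sets of the form `active F f b x`, for `x` in the polyhedron, are exactly the sets
satisfying `N`, then the face poset is anti-isomorphic to the poset of these sets. -/
def facePosetIso (hF : F.Finite) (ht : t ∈ F) (N : Set K → Prop)
    (hact : ∀ x ∈ polyhedron F t f b, N (active F f b x))
    (hN : ∀ S, N S → ∃ x ∈ polyhedron F t f b, active F f b x = S) :
    (FacePoset (polyhedron F t f b))ᵒᵈ ≃o {S // N S} := by
  have hne : ∀ S, N S → (faceOf F t f b S).Nonempty := fun S hS => by
    obtain ⟨x, hx, rfl⟩ := hN S hS
    exact ⟨x, hx, Subset.rfl⟩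
  have hsub : ∀ S, N S → S ⊆ F := fun S hS => by
    obtain ⟨x, hx, rfl⟩ := hN S hS
    exact active_subset
  let φ : {S // N S} → (FacePoset (polyhedron F t f b))ᵒᵈ := fun S =>
    OrderDual.toDual ⟨faceOf F t f b S, isExposed_faceOf hF (hsub S S.2) (hne S S.2), hne S S.2⟩
  have hφ : ∀ S T, φ S ≤ φ T ↔ S ≤ T := by
    rintro ⟨S, hS⟩ ⟨T, hT⟩
    change faceOf F t f b T ⊆ faceOf F t f b S ↔ S ⊆ T
    refine ⟨fun h => ?_, fun h x hx => ⟨hx.1, h.trans hx.2⟩⟩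
    obtain ⟨x, hx, rfl⟩ := hN T hT
    exact (h ⟨hx, Subset.rfl⟩).2
  refine (RelIso.ofSurjective (OrderEmbedding.ofMapLEIff φ hφ) ?_).symm
  intro B
  obtain ⟨⟨B, hB, hBne⟩, rfl⟩ := OrderDual.toDual.surjective B
  obtain ⟨x, hx, rfl⟩ := exists_eq_faceOf hF ht hB hBne
  exact ⟨⟨active F f b x, hact x hx⟩, rfl⟩

lemma isPolytope_polyhedron [FiniteDimensional ℝ E] (hF : F.Finite) (ht : t ∈ F)
    (hc : IsCompact (polyhedron F t f b)) : IsPolytope (polyhedron F t f b) := by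
  have hfin : ((polyhedron F t f b).extremePoints ℝ).Finite := by
    refine Set.Finite.of_injOn (f := active F f b) (t := 𝒫 F) (fun x _ => active_subset) ?_
      hF.finite_subsets
    intro x hx z hz h
    exact (eq_of_mem_extremePoints hF ht hx hz.1 h.le).symm
  refine ⟨_, hfin, ?_⟩
  exact (closure_convexHull_extremePoints hc convex_polyhedron).symm.trans
    (hfin.isClosed_convexHull ℝ).closure_eq

/-- If `S` is a maximal set of simultaneously active inequalities of a compact polyhedron, then
their normal vectors span: the face where they are active contains a vertex, and there is no room
to move at a vertex. -/
lemma eq_zero_of_maximal_active [FiniteDimensional ℝ E] (hF : F.Finite) (ht : t ∈ F)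
    (hc : IsCompact (polyhedron F t f b)) (hx : x ∈ polyhedron F t f b)
    (hmax : ∀ z ∈ polyhedron F t f b, active F f b x ⊆ active F f b z →
      active F f b z = active F f b x)
    (hu : ∀ A ∈ active F f b x, f A u = 0) : u = 0 := by
  have hexp := isExposed_faceOf (t := t) hF (active_subset (x := x)) ⟨x, hx, Subset.rfl⟩
  obtain ⟨z, hz⟩ := (hexp.isCompact hc).extremePoints_nonempty ⟨x, hx, Subset.rfl⟩
  have hzP := hexp.isExtreme.extremePoints_subset_extremePoints hz
  have hzx := hmax z hzP.1 hz.1.2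
  obtain ⟨r, hr, h⟩ := exists_add_smul_mem (u := u) hF ht hzP.1 (by rwa [hzx])
  have h1 := eq_of_mem_extremePoints hF ht hzP h fun A hA => ⟨hA.1, by
    rw [map_add, map_smul, hu A (hzx ▸ hA), smul_zero, add_zero, hA.2]⟩
  simpa [hr.ne'] using h1

lemma mem_extremePoints_of_active (hx : x ∈ polyhedron F t f b)
    (huniq : ∀ z ∈ polyhedron F t f b, active F f b x ⊆ active F f b z → z = x) :
    x ∈ (polyhedron F t f b).extremePoints ℝ := by
  refine mem_extremePoints_iff_left.2 ⟨hx, ?_⟩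
  rintro y hy z hz ⟨r, s, hr, hs, hrs, rfl⟩
  exact huniq y hy ((active_combo_subset hy hz hr hs hrs).trans inter_subset_left)

end Polyhedra

/-! ### Coordinate subspaces and nested sets -/

section Combinatorics

variable {V : Type*} [AddCommGroup V] [Module ℝ V] {n : ℕ} {α : Module.Basis (Fin n) ℝ V}
  {F S : Set (Submodule ℝ V)} {A B C : Submodule ℝ V} {i : Fin n}

open Classical in
/-- The set of the indices of the basis vectors that lie in `A`. -/
def supp (α : Module.Basis (Fin n) ℝ V) (A : Submodule ℝ V) : Finset (Fin n) :=
  Finset.univ.filter fun i => α i ∈ A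

/-- The combinatorial properties of `G_fund` on which the nested set complex depends: a set of
nonzero subspaces spanned by basis vectors that contains the whole space and, with two subspaces
sharing a basis vector, also their sum. -/
structure IsCoordBuilding (α : Module.Basis (Fin n) ℝ V) (F : Set (Submodule ℝ V)) : Prop where
  eq_span : ∀ A ∈ F, A = Submodule.span ℝ (α '' (supp α A : Set (Fin n)))
  bot_notMem : ⊥ ∉ F
  top_mem : ⊤ ∈ F
  sup_mem : ∀ A ∈ F, ∀ B ∈ F, ¬ Disjoint (supp α A) (supp α B) → A ⊔ B ∈ F

@[simp] lemma mem_supp : i ∈ supp α A ↔ α i ∈ A := by simp [supp]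

lemma supp_mono (h : A ≤ B) : supp α A ⊆ supp α B := fun i hi => by
  rw [mem_supp] at *; exact h hi

lemma supp_top : supp α (⊤ : Submodule ℝ V) = Finset.univ := by ext; simp

lemma card_supp_le (A : Submodule ℝ V) : (supp α A).card ≤ n := by
  simpa using Finset.card_le_univ (supp α A)

lemma finrank_top_eq (α : Module.Basis (Fin n) ℝ V) :
    Module.finrank ℝ (⊤ : Submodule ℝ V) = n := by
  rw [finrank_top, Module.finrank_eq_card_basis α, Fintype.card_fin]

lemma mem_supp_span {I : Set (Fin n)} : i ∈ supp α (Submodule.span ℝ (α '' I)) ↔ i ∈ I := by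
  rw [mem_supp, α.mem_span_image]
  simp [Module.Basis.repr_self]

lemma span_image_supp {I : Set (Fin n)} :
    Submodule.span ℝ (α '' I) =
      Submodule.span ℝ (α '' (supp α (Submodule.span ℝ (α '' I)) : Set (Fin n))) := by
  congr 2
  ext i
  exact mem_supp_span.symm

namespace IsCoordBuilding

variable (h : IsCoordBuilding α F)
include h

lemma supp_subset_iff (hA : A ∈ F) : supp α A ⊆ supp α B ↔ A ≤ B := by
  refine ⟨fun hs => ?_, supp_mono⟩
  rw [h.eq_span A hA, Submodule.span_le]
  rintro _ ⟨i, hi, rfl⟩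
  exact mem_supp.1 (hs hi)

lemma supp_ssubset (hB : B ∈ F) (hlt : A < B) : supp α A ⊂ supp α B :=
  ⟨supp_mono hlt.le, fun hs => hlt.not_ge ((h.supp_subset_iff hB).1 hs)⟩

lemma card_lt_card (hB : B ∈ F) (hlt : A < B) :
    (supp α A).card < (supp α B).card :=
  Finset.card_lt_card (h.supp_ssubset hB hlt)

lemma supp_nonempty (hA : A ∈ F) : (supp α A).Nonempty := by
  rw [Finset.nonempty_iff_ne_empty]
  intro h0
  apply h.bot_notMem
  have hbot := h.eq_span A hA
  rw [h0, Finset.coe_empty, Set.image_empty, Submodule.span_empty] at hbot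
  exact hbot ▸ hA

lemma finrank_eq (hA : A ∈ F) : Module.finrank ℝ A = (supp α A).card := by
  have hli : LinearIndependent ℝ (fun i : (supp α A) => α i) :=
    α.linearIndependent.comp _ Subtype.val_injective
  have h1 := finrank_span_eq_card hli
  have h2 : Set.range (fun i : (supp α A) => α i) = α '' (supp α A : Set (Fin n)) := by
    ext; simp
  rw [h2, ← h.eq_span A hA, Fintype.card_coe] at h1
  exact h1

lemma finite : F.Finite :=
  (Set.finite_range fun I : Finset (Fin n) => Submodule.span ℝ (α '' (I : Set (Fin n)))).subset
    fun A hA => ⟨supp α A, (h.eq_span A hA).symm⟩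

lemma mem_supp_sSup {T : Set (Submodule ℝ V)} (hT : T ⊆ F) :
    i ∈ supp α (sSup T) ↔ ∃ A ∈ T, i ∈ supp α A := by
  refine ⟨fun hi => ?_, fun ⟨A, hA, hi⟩ => supp_mono (le_sSup hA) hi⟩
  have h1 : sSup T ≤ Submodule.span ℝ (α '' {i | ∃ A ∈ T, i ∈ supp α A}) := by
    refine sSup_le fun A hA => ?_
    rw [h.eq_span A (hT hA)]
    exact Submodule.span_mono (Set.image_mono fun i hi => ⟨A, hA, hi⟩)
  exact mem_supp_span.1 (supp_mono h1 hi)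

lemma supp_sup (hA : A ∈ F) (hB : B ∈ F) : supp α (A ⊔ B) = supp α A ∪ supp α B := by
  ext i
  have := h.mem_supp_sSup (i := i) (T := {A, B}) (by
    rintro _ (rfl | rfl) <;> assumption)
  rw [sSup_pair] at this
  simpa using this

/-- A member of `F` together with members of `F` that all share a basis vector with it has its sum
in `F`. -/
lemma sup_sSup_mem (hC : C ∈ F) {T : Set (Submodule ℝ V)} (hT : T ⊆ F)
    (hd : ∀ B ∈ T, ¬ Disjoint (supp α C) (supp α B)) : C ⊔ sSup T ∈ F := by
  have hfin := h.finite.subset hT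
  induction T, hfin using Set.Finite.induction_on with
  | empty => simpa using hC
  | @insert B T _ _ ih =>
    rw [sSup_insert, sup_left_comm, sup_comm]
    refine h.sup_mem _ (ih (fun D hD => hT (Or.inr hD)) fun D hD => hd D (Or.inr hD)) _
      (hT (Or.inl rfl)) fun hdis => hd B (Or.inl rfl) ?_
    exact hdis.mono_left (supp_mono le_sup_left)

/-- Two members of a nested set are comparable or share no basis vector. -/
lemma le_or_le_of_isNested (hS : IsNested F S) (hA : A ∈ S) (hB : B ∈ S)
    (hd : ¬ Disjoint (supp α A) (supp α B)) : A ≤ B ∨ B ≤ A := by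
  by_contra! hc
  have hne : A ≠ B := fun e => hc.1 e.le
  refine hS.2 {A, B} ?_ ⟨A, by simp, B, by simp, hne⟩ ?_ ?_
  · rintro _ (rfl | rfl) <;> assumption
  · rintro x (rfl | rfl) y (rfl | rfl) hxy
    · exact absurd rfl hxy
    · exact hc.1
    · exact hc.2
    · exact absurd rfl hxy
  · rw [sSup_pair]
    exact h.sup_mem _ (hS.1 hA) _ (hS.1 hB) hd

lemma exists_le_maximal (hS : S ⊆ F) (hA : A ∈ S) : ∃ B, A ≤ B ∧ Maximal (· ∈ S) B := by
  exact (h.finite.subset hS).exists_le_maximal hA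

/-- A member of `F` that lies in no member of a nested set is not covered by the nested set:
otherwise, the maximal members of the nested set that meet it would have their sum in `F`. -/
lemma exists_mem_supp_forall_notMem (hS : IsNested F S) (hC : C ∈ F) (hn : ∀ B ∈ S, ¬ C ≤ B) :
    ∃ i ∈ supp α C, ∀ B ∈ S, i ∉ supp α B := by
  by_contra! hc
  set T := {B | Maximal (· ∈ S) B ∧ ¬ Disjoint (supp α C) (supp α B)} with hTdef
  have hTS : T ⊆ S := fun B hB => hB.1.prop
  have hcov : ∀ i ∈ supp α C, ∃ B ∈ T, i ∈ supp α B := by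
    intro i hi
    obtain ⟨B, hB, hiB⟩ := hc i hi
    obtain ⟨D, hBD, hD⟩ := h.exists_le_maximal hS.1 hB
    exact ⟨D, ⟨hD, Finset.not_disjoint_iff.2 ⟨i, hi, supp_mono hBD hiB⟩⟩, supp_mono hBD hiB⟩
  have hle : C ≤ sSup T := by
    rw [← h.supp_subset_iff hC]
    exact fun i hi => (h.mem_supp_sSup (hTS.trans hS.1)).2 (hcov i hi)
  have hmem := h.sup_sSup_mem hC (hTS.trans hS.1) fun B hB => hB.2
  rw [sup_eq_right.2 hle] at hmem
  obtain ⟨i, hi⟩ := h.supp_nonempty hC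
  obtain ⟨B, hB, -⟩ := hcov i hi
  by_cases hT : T.Nontrivial
  · exact hS.2 T hTS hT (fun D hD E hE hne hDE => hne (hD.1.eq_of_le hE.1.prop hDE)) hmem
  · rw [Set.not_nontrivial_iff] at hT
    have : T = {B} := hT.eq_singleton_of_mem hB
    rw [this, sSup_singleton] at hle
    exact hn B (hTS hB) hle

/-- Among the members of a nested set that contain given basis vectors, at least one in number,
there is a least one. -/
lemma exists_least (hS : IsNested F S) (hA : A ∈ S) {I : Finset (Fin n)} (hI : I.Nonempty)
    (hIA : I ⊆ supp α A) :
    ∃ B ∈ S, I ⊆ supp α B ∧ ∀ D ∈ S, I ⊆ supp α D → B ≤ D := by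
  obtain ⟨B, -, hB⟩ := ((h.finite.subset hS.1).subset
    (Set.sep_subset S fun B => I ⊆ supp α B)).exists_le_minimal ⟨hA, hIA⟩
  refine ⟨B, hB.prop.1, hB.prop.2, fun D hD hID => ?_⟩
  obtain ⟨i, hi⟩ := hI
  rcases h.le_or_le_of_isNested hS hB.prop.1 hD
    (Finset.not_disjoint_iff.2 ⟨i, hB.prop.2 hi, hID hi⟩) with hle | hle
  · exact hle
  · exact hB.le_of_le ⟨hD, hID⟩ hle

/-- Every index `i` has an owner: the least member of the nested set that contains the basis vector
`i`. Every member of the nested set owns some index. -/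
lemma exists_owner (hS : IsNested F S) (htop : ⊤ ∈ S) :
    ∃ own : Fin n → Submodule ℝ V, (∀ i, own i ∈ S) ∧ (∀ i, i ∈ supp α (own i)) ∧
      (∀ i, ∀ D ∈ S, i ∈ supp α D → own i ≤ D) ∧ ∀ A ∈ S, ∃ i, own i = A := by
  have : ∀ i : Fin n, ∃ B ∈ S, i ∈ supp α B ∧ ∀ D ∈ S, i ∈ supp α D → B ≤ D := fun i => by
    simpa using h.exists_least hS htop (Finset.singleton_nonempty i) (by simp [supp_top])
  choose own h1 h2 h3 using this
  refine ⟨own, h1, h2, h3, fun A hA => ?_⟩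
  have hS' : IsNested F {B ∈ S | B < A} :=
    ⟨fun B hB => hS.1 hB.1, fun T hT => hS.2 T fun B hB => (hT hB).1⟩
  obtain ⟨i, hi, hi'⟩ := h.exists_mem_supp_forall_notMem hS' (hS.1 hA) fun B hB => hB.2.not_ge
  refine ⟨i, (h3 i A hA hi).eq_of_not_lt fun hlt => hi' _ ⟨h1 i, hlt⟩ (h2 i)⟩

lemma encard_le (hS : IsNested F S) (htop : ⊤ ∈ S) : S.encard ≤ n := by
  obtain ⟨own, -, -, -, hsurj⟩ := h.exists_owner hS htop
  calc S.encard ≤ (own '' Set.univ).encard := Set.encard_le_encard fun A hA => by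
        obtain ⟨i, rfl⟩ := hsurj A hA; exact ⟨i, trivial, rfl⟩
    _ ≤ (Set.univ : Set (Fin n)).encard := Set.encard_image_le _ _
    _ = n := by simp

end IsCoordBuilding

lemma IsMaximalNested.top_mem (h : IsCoordBuilding α F)
    (hS : IsMaximalNested F S) : ⊤ ∈ S := by
  have hN : IsNested F (insert ⊤ S) := by
    refine ⟨Set.insert_subset h.top_mem hS.prop.1, fun T hT hnt hanti => ?_⟩
    refine hS.prop.2 T (fun A hA => ?_) hnt hanti
    rcases hT hA with rfl | hA'
    · obtain ⟨B, hB, hne⟩ := hnt.exists_ne ⊤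
      exact absurd le_top (hanti hB hA hne)
    · exact hA'
  exact hS.le_of_ge hN (Set.subset_insert _ _) (Set.mem_insert _ _)

end Combinatorics

/-! ### Points with prescribed active sets -/

section Weights

variable {V : Type*} [AddCommGroup V] [Module ℝ V] {n : ℕ} {α : Module.Basis (Fin n) ℝ V}
  {F S : Set (Submodule ℝ V)} {A B C : Submodule ℝ V} {i : Fin n}
  {k : Submodule ℝ V → Fin n → ℝ} {y : Fin n → ℝ}

/-- Positive weights `k A i`, for `A ∈ F` and basis vectors `i` in `A`, that strictly decrease as
`A` grows. -/
structure IsDecreasingWeight (α : Module.Basis (Fin n) ℝ V) (F : Set (Submodule ℝ V))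
    (k : Submodule ℝ V → Fin n → ℝ) : Prop where
  pos : ∀ A ∈ F, ∀ i ∈ supp α A, 0 < k A i
  lt : ∀ A ∈ F, ∀ B ∈ F, B < A → ∀ i ∈ supp α B, k A i < k B i

/-- The weighted sum of the coordinates of `y` indexed by the basis vectors in `A`. -/
def weightedSum (α : Module.Basis (Fin n) ℝ V) (k : Submodule ℝ V → Fin n → ℝ)
    (A : Submodule ℝ V) (y : Fin n → ℝ) : ℝ :=
  ∑ i ∈ supp α A, k A i * y i

lemma sum_two_pow_le {ι : Type*} (T : Finset ι) (b : ι → ℕ) (hb : ∀ j ∈ T, 1 ≤ b j) :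
    ∑ j ∈ T, (2 : ℝ) ^ b j ≤ 2 ^ ∑ j ∈ T, b j := by
  classical
  induction T using Finset.induction_on with
  | empty => simp
  | insert a T ha ih =>
    rw [Finset.sum_insert ha, Finset.sum_insert ha, pow_add]
    have h1 := ih fun j hj => hb j (Finset.mem_insert_of_mem hj)
    have h2 : (2 : ℝ) ^ 1 ≤ 2 ^ b a :=
      pow_le_pow_right₀ (by norm_num) (hb a (Finset.mem_insert_self _ _))
    rcases T.eq_empty_or_nonempty with rfl | ⟨j, hj⟩
    · simp
    · have h3 : (2 : ℝ) ^ 1 ≤ 2 ^ ∑ j ∈ T, b j :=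
        pow_le_pow_right₀ (by norm_num) ((hb j (Finset.mem_insert_of_mem hj)).trans
          (Finset.single_le_sum (fun _ _ => Nat.zero_le _) hj))
      nlinarith

/-- If the amount `s ≤ c * p` is shared evenly among `x + y ≤ p * x` indices, then the share of `x`
of them together with the rest of `c * p` is at least `c`. -/
lemma le_even_share_add {x y c p s : ℝ} (hxy : 0 < x + y) (hy : 0 ≤ y) (hc : 0 ≤ c)
    (hp : x + y ≤ p * x) (hs : s ≤ c * p) : c ≤ x * (s / (x + y)) + (c * p - s) := by
  have h1 : x * (s / (x + y)) + (c * p - s) = c * p - s * (y / (x + y)) := by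
    field_simp
    ring
  have h2 : s * (y / (x + y)) ≤ c * p * (y / (x + y)) :=
    mul_le_mul_of_nonneg_right hs (div_nonneg hy hxy.le)
  have h3 : c * p - c * p * (y / (x + y)) = c * (p * x / (x + y)) := by
    field_simp
    ring
  have h4 := le_mul_of_one_le_right hc ((one_le_div hxy).2 hp)
  linarith

/-- A system of equations expressing each `y i` through the `y j` of smaller rank is solvable. -/
lemma exists_solution_of_rank {ι : Type*} (d : ι → ℕ) (G : ι → (ι → ℝ) → ℝ) :
    ∃ y : ι → ℝ, ∀ i, y i = G i fun j => if d j < d i then y j else 0 := by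
  have hwf : WellFounded fun i j : ι => d i < d j := InvImage.wf d Nat.lt_wfRel.wf
  refine ⟨hwf.fix fun i rec => G i fun j => if hj : d j < d i then rec j hj else 0, fun i => ?_⟩
  rw [hwf.fix_eq]
  rfl

/-- Let the `B ∈ T` be proper subspaces of `A` without common basis vectors on which the weighted
sum is as small as allowed. Then the weights of `A` give an even smaller sum to their union. -/
lemma sum_biUnion_lt (h : IsCoordBuilding α F) (hk : IsDecreasingWeight α F k) (hA : A ∈ F)
    (T : Finset (Submodule ℝ V)) (hT : T.Nonempty) (hTF : ∀ B ∈ T, B ∈ F) (hTA : ∀ B ∈ T, B < A)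
    (hd : Set.PairwiseDisjoint (T : Set (Submodule ℝ V)) (supp α))
    (hy : ∀ B ∈ T, ∀ i ∈ supp α B, 0 < y i)
    (hs : ∀ B ∈ T, weightedSum α k B y = 2 ^ (supp α B).card) :
    ∑ i ∈ T.biUnion (supp α), k A i * y i < 2 ^ (T.biUnion (supp α)).card := by
  rw [Finset.sum_biUnion hd, Finset.card_biUnion hd]
  refine lt_of_lt_of_le (Finset.sum_lt_sum_of_nonempty hT (g := fun B => 2 ^ (supp α B).card)
    fun B hB => ?_) (sum_two_pow_le T _ fun B hB => (h.supp_nonempty (hTF B hB)).card_pos)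
  rw [← hs B hB]
  exact Finset.sum_lt_sum_of_nonempty (h.supp_nonempty (hTF B hB)) fun i hi =>
    mul_lt_mul_of_pos_right (hk.lt A hA B (hTF B hB) (hTA B hB) i hi) (hy B hB i hi)

/-- The members of `F` whose inequalities are active at a given point form a nested set. -/
lemma isNested_of_weightedSum_eq (h : IsCoordBuilding α F) (hk : IsDecreasingWeight α F k)
    (hy : ∀ i, 0 < y i) (hF : ∀ A ∈ F, 2 ^ (supp α A).card ≤ weightedSum α k A y)
    (hS : S ⊆ F) (hs : ∀ A ∈ S, weightedSum α k A y = 2 ^ (supp α A).card) : IsNested F S := by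
  classical
  -- Two members that are not comparable share no basis vector, as otherwise their sum is in `F`.
  have hpair : ∀ A ∈ S, ∀ B ∈ S, ¬ A ≤ B → ¬ B ≤ A → Disjoint (supp α A) (supp α B) := by
    intro A hA B hB hAB hBA
    by_contra hd
    have hC := h.sup_mem A (hS hA) B (hS hB) hd
    have hAC : A < A ⊔ B := left_lt_sup.2 hBA
    have hBC : B < A ⊔ B := right_lt_sup.2 hAB
    have h1 : ∀ D ∈ S, D < A ⊔ B →
        ∑ i ∈ supp α D, k (A ⊔ B) i * y i < 2 ^ (supp α D).card := by
      intro D hD hlt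
      rw [← hs D hD]
      exact Finset.sum_lt_sum_of_nonempty (h.supp_nonempty (hS hD)) fun i hi =>
        mul_lt_mul_of_pos_right (hk.lt _ hC D (hS hD) hlt i hi) (hy i)
    have h2 : weightedSum α k (A ⊔ B) y ≤
        ∑ i ∈ supp α A, k (A ⊔ B) i * y i + ∑ i ∈ supp α B, k (A ⊔ B) i * y i := by
      rw [← Finset.sum_union_inter, weightedSum, h.supp_sup (hS hA) (hS hB)]
      refine le_add_of_nonneg_right (Finset.sum_nonneg fun i hi => mul_nonneg ?_ (hy i).le)
      exact (hk.pos _ hC i (supp_mono le_sup_left (Finset.mem_inter.1 hi).1)).le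
    have h3 : ∀ D : Submodule ℝ V, (supp α D).card < (supp α (A ⊔ B)).card →
        (2 : ℝ) * 2 ^ (supp α D).card ≤ 2 ^ (supp α (A ⊔ B)).card := fun D hD => by
      rw [← pow_succ']
      exact pow_le_pow_right₀ (by norm_num) hD
    linarith [h1 A hA hAC, h1 B hB hBC, h3 A (h.card_lt_card hC hAC),
      h3 B (h.card_lt_card hC hBC), hF _ hC]
  refine ⟨hS, fun T hT hnt hanti hmem => ?_⟩
  set T' := (h.finite.subset (hT.trans hS)).toFinset with hT'
  have hmT : ∀ B, B ∈ T' ↔ B ∈ T := fun B => by simp [hT']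
  have hlt : ∀ B ∈ T, B < sSup T := by
    intro B hB
    obtain ⟨D, hD, hne⟩ := hnt.exists_ne B
    refine (le_sSup hB).lt_of_ne fun heq => hanti hD hB hne ?_
    rw [heq]
    exact le_sSup hD
  have hunion : T'.biUnion (supp α) = supp α (sSup T) := by
    ext i
    rw [h.mem_supp_sSup (hT.trans hS)]
    simp [hmT]
  have := sum_biUnion_lt h hk hmem T' (by
      obtain ⟨B, hB⟩ := hnt.nonempty
      exact ⟨B, (hmT B).2 hB⟩) (fun B hB => hS (hT ((hmT B).1 hB)))
    (fun B hB => hlt B ((hmT B).1 hB)) (fun B hB D hD hne => by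
      rw [Finset.mem_coe, hmT] at hB hD
      exact hpair B (hT hB) D (hT hD) (hanti hB hD hne) (hanti hD hB hne.symm))
    (fun B _ i _ => hy i) (fun B hB => hs B (hT ((hmT B).1 hB)))
  rw [hunion] at this
  exact (hF _ hmem).not_gt this

/-- For every nested set `S` containing the whole space there is a positive point at which exactly
the inequalities of the members of `S` are active. For `A ∈ S`, the part of the weighted sum over
`A` that is not accounted for by the smaller members of `S` is distributed evenly among the basis
vectors owned by `A`. -/
lemma exists_weightedSum_eq_iff (h : IsCoordBuilding α F) (hk : IsDecreasingWeight α F k)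
    (hS : IsNested F S) (htop : ⊤ ∈ S) :
    ∃ y : Fin n → ℝ, (∀ i, 0 < y i) ∧ ∀ A ∈ F, 2 ^ (supp α A).card ≤ weightedSum α k A y ∧
      (weightedSum α k A y = 2 ^ (supp α A).card ↔ A ∈ S) := by
  classical
  obtain ⟨own, ownS, mem_own, own_le, own_surj⟩ := h.exists_owner hS htop
  -- `U A` are the basis vectors owned by `A`, and `D A` the other ones in `A`.
  let U : Submodule ℝ V → Finset (Fin n) := fun A => (supp α A).filter fun i => own i = A
  let D : Submodule ℝ V → Finset (Fin n) := fun A => (supp α A).filter fun i => ¬ own i = A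
  have hmD : ∀ A ∈ S, ∀ i, i ∈ D A ↔ own i < A := by
    intro A hA i
    simp only [D, Finset.mem_filter]
    exact ⟨fun hi => (own_le i A hA hi.1).lt_of_ne hi.2,
      fun hi => ⟨supp_mono hi.le (mem_own i), hi.ne⟩⟩
  have hUne : ∀ A ∈ S, 0 < (U A).card := by
    intro A hA
    obtain ⟨i, rfl⟩ := own_surj A hA
    exact Finset.card_pos.2 ⟨i, Finset.mem_filter.2 ⟨mem_own i, rfl⟩⟩
  have hcard : ∀ A, (U A).card + (D A).card = (supp α A).card := fun A =>
    Finset.card_filter_add_card_filter_not _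
  obtain ⟨y, hy⟩ := exists_solution_of_rank (fun i => (supp α (own i)).card) fun i z =>
    (2 ^ (supp α (own i)).card - ∑ j ∈ D (own i), k (own i) j * z j) /
      ((U (own i)).card * k (own i) i)
  let s : Submodule ℝ V → ℝ := fun A => 2 ^ (supp α A).card - ∑ j ∈ D A, k A j * y j
  have hyU : ∀ A ∈ S, ∀ i ∈ U A, k A i * y i = s A / (U A).card := by
    intro A hA i hi
    obtain ⟨hiA, rfl⟩ := Finset.mem_filter.1 hi
    have hki := (hk.pos _ (hS.1 hA) i hiA).ne'
    have hsum : ∑ j ∈ D (own i), k (own i) j *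
        (if (supp α (own j)).card < (supp α (own i)).card then y j else 0) =
        ∑ j ∈ D (own i), k (own i) j * y j := by
      refine Finset.sum_congr rfl fun j hj => ?_
      rw [if_pos (h.card_lt_card (hS.1 hA) ((hmD _ hA j).1 hj))]
    have hUi : ((U (own i)).card : ℝ) ≠ 0 := by exact_mod_cast (hUne _ hA).ne'
    rw [hy i, hsum]
    change k (own i) i * (s (own i) / ((U (own i)).card * k (own i) i)) = _
    field_simp
  have hsumU : ∀ A ∈ S, ∑ i ∈ U A, k A i * y i = s A := by
    intro A hA
    rw [Finset.sum_congr rfl (hyU A hA), Finset.sum_const, nsmul_eq_mul]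
    have hUi : ((U A).card : ℝ) ≠ 0 := by exact_mod_cast (hUne _ hA).ne'
    field_simp
  have hval : ∀ A ∈ S, weightedSum α k A y = 2 ^ (supp α A).card := by
    intro A hA
    rw [weightedSum, ← Finset.sum_filter_add_sum_filter_not (supp α A) (fun i => own i = A)]
    change ∑ i ∈ U A, k A i * y i + ∑ i ∈ D A, k A i * y i = _
    rw [hsumU A hA]
    simp [s]
  -- The smaller members of `S` account for at most half of the weighted sum over `A`.
  have hhalf : ∀ A ∈ S, (∀ j ∈ D A, 0 < y j) → 2 ^ (supp α A).card ≤ 2 * s A := by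
    intro A hA hpos
    have hD : ∑ j ∈ D A, k A j * y j ≤ 2 ^ (D A).card := by
      set T := {B | Maximal (· ∈ {B ∈ S | B < A}) B}
      have hTS : T ⊆ {B ∈ S | B < A} := fun B hB => hB.prop
      have hTfin : T.Finite := h.finite.subset fun B hB => hS.1 (hTS hB).1
      have hunion : hTfin.toFinset.biUnion (supp α) = D A := by
        ext i
        rw [hmD A hA, Finset.mem_biUnion]
        constructor
        · rintro ⟨B, hB, hi⟩
          have hB' := hTS (hTfin.mem_toFinset.1 hB)
          exact (own_le i B hB'.1 hi).trans_lt hB'.2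
        · intro hi
          obtain ⟨B, hB, hmax⟩ := h.exists_le_maximal (S := {B ∈ S | B < A})
            (fun B hB => hS.1 hB.1) ⟨ownS i, hi⟩
          exact ⟨B, hTfin.mem_toFinset.2 hmax, supp_mono hB (mem_own i)⟩
      rcases hTfin.toFinset.eq_empty_or_nonempty with h0 | hne
      · rw [h0, Finset.biUnion_empty] at hunion
        simp [← hunion]
      · rw [← hunion]
        refine (sum_biUnion_lt h hk (hS.1 hA) _ hne
          (fun B hB => hS.1 (hTS (hTfin.mem_toFinset.1 hB)).1)
          (fun B hB => (hTS (hTfin.mem_toFinset.1 hB)).2) ?_ ?_ ?_).le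
        · intro B hB C hC hne
          rw [Finset.mem_coe, hTfin.mem_toFinset] at hB hC
          by_contra hd
          rcases h.le_or_le_of_isNested hS (hTS hB).1 (hTS hC).1 hd with hle | hle
          · exact hne (hB.eq_of_le hC.prop hle)
          · exact hne (hC.eq_of_le hB.prop hle).symm
        · intro B hB i hi
          refine hpos i ?_
          rw [← hunion]
          exact Finset.mem_biUnion.2 ⟨B, hB, hi⟩
        · exact fun B hB => hval B (hTS (hTfin.mem_toFinset.1 hB)).1
    have h1 : (2 : ℝ) * 2 ^ (D A).card ≤ 2 ^ (supp α A).card := by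
      rw [← pow_succ', ← hcard A]
      exact pow_le_pow_right₀ (by norm_num) (by have := hUne A hA; omega)
    simp only [s]
    linarith
  have hypos : ∀ i, 0 < y i := by
    intro i
    induction hm : (supp α (own i)).card using Nat.strong_induction_on generalizing i with
    | _ m ih =>
      have h1 := hhalf (own i) (ownS i) fun j hj =>
        ih _ (hm ▸ h.card_lt_card (hS.1 (ownS i)) ((hmD _ (ownS i) j).1 hj)) j rfl
      have h2 : (0 : ℝ) < 2 ^ (supp α (own i)).card := by positivity
      have h3 := hyU (own i) (ownS i) i (Finset.mem_filter.2 ⟨mem_own i, rfl⟩)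
      have h4 : (0 : ℝ) < (U (own i)).card := by exact_mod_cast hUne _ (ownS i)
      have h5 : 0 < k (own i) i * y i := by
        rw [h3]
        exact div_pos (by linarith) h4
      exact pos_of_mul_pos_right h5 (hk.pos _ (hS.1 (ownS i)) i (mem_own i)).le
  refine ⟨y, hypos, fun C hC => ?_⟩
  by_cases hCS : C ∈ S
  · exact ⟨(hval C hCS).ge, by simp [hCS, hval C hCS]⟩
  suffices hlt : 2 ^ (supp α C).card < weightedSum α k C y from
    ⟨hlt.le, iff_of_false hlt.ne' hCS⟩
  obtain ⟨A, hA, hCA, hleast⟩ := h.exists_least hS htop (h.supp_nonempty hC) (by simp [supp_top])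
  have hCltA : C < A := by
    refine ((h.supp_subset_iff hC).1 hCA).lt_of_ne ?_
    rintro rfl
    exact hCS hA
  have hkpos : ∀ j ∈ supp α A, 0 < k A j * y j := fun j hj =>
    mul_pos (hk.pos A (hS.1 hA) j hj) (hypos j)
  refine lt_of_le_of_lt ?_ (Finset.sum_lt_sum_of_nonempty (h.supp_nonempty hC) fun i hi =>
    mul_lt_mul_of_pos_right (hk.lt A (hS.1 hA) C hC hCltA i hi) (hypos i))
  -- `X` are the basis vectors owned by `A` that lie in `C`, and `Y` those that do not.
  set X := (U A).filter fun i => i ∈ supp α C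
  set Y := (U A).filter fun i => ¬ i ∈ supp α C
  have hXY : X.card + Y.card = (U A).card := Finset.card_filter_add_card_filter_not _
  have hX : 0 < X.card := by
    have hS' : IsNested F {B ∈ S | B < A} :=
      ⟨fun B hB => hS.1 hB.1, fun T hT => hS.2 T fun B hB => (hT hB).1⟩
    obtain ⟨i, hi, hi'⟩ := h.exists_mem_supp_forall_notMem hS' hC fun B hB hCB =>
      hB.2.not_ge (hleast B hB.1 (supp_mono hCB))
    have hiA : own i = A := (own_le i A hA (hCA hi)).eq_of_not_lt
      fun hlt => hi' _ ⟨ownS i, hlt⟩ (mem_own i)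
    exact Finset.card_pos.2 ⟨i, Finset.mem_filter.2 ⟨Finset.mem_filter.2 ⟨hCA hi, hiA⟩, hi⟩⟩
  have hsumX : ∑ i ∈ X, k A i * y i = X.card * (s A / (U A).card) := by
    rw [Finset.sum_congr rfl fun i hi => hyU A hA i (Finset.mem_filter.1 hi).1,
      Finset.sum_const, nsmul_eq_mul]
  have hs0 := hhalf A hA fun j _ => hypos j
  have hs1 : s A ≤ 2 ^ (supp α A).card :=
    sub_le_self _ (Finset.sum_nonneg fun j hj => (hkpos j (Finset.mem_filter.1 hj).1).le)
  have hpow : ((X.card : ℝ) + Y.card) ≤ 2 ^ Y.card * X.card := by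
    have h1 : Y.card + 1 ≤ 2 ^ Y.card := Nat.lt_two_pow_self
    have h2 : X.card + Y.card ≤ 2 ^ Y.card * X.card := by nlinarith
    exact_mod_cast h2
  have hU : (0 : ℝ) < X.card + Y.card := by exact_mod_cast (by omega)
  have hUXY : ((U A).card : ℝ) = X.card + Y.card := by exact_mod_cast hXY.symm
  rw [hUXY] at hsumX
  have hC2 : (0 : ℝ) < 2 ^ (supp α C).card := by positivity
  have hXC : X ⊆ supp α C := fun i hi => (Finset.mem_filter.1 hi).2
  by_cases hDC : D A ⊆ supp α C
  · -- Only `Y` is missing in `C`.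
    have hsub : X ∪ D A ⊆ supp α C := Finset.union_subset hXC hDC
    have hdis : Disjoint X (D A) := Finset.disjoint_left.2 fun i hi hi' =>
      (Finset.mem_filter.1 hi').2 (Finset.mem_filter.1 (Finset.mem_filter.1 hi).1).2
    have hceq : (supp α A).card = (supp α C).card + Y.card := by
      have h1 : supp α C ⊆ X ∪ D A := fun i hi => by
        by_cases hiA : own i = A
        · exact Finset.mem_union_left _ (Finset.mem_filter.2
            ⟨Finset.mem_filter.2 ⟨hCA hi, hiA⟩, hi⟩)
        · exact Finset.mem_union_right _ (Finset.mem_filter.2 ⟨hCA hi, hiA⟩)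
      rw [h1.antisymm hsub, Finset.card_union_of_disjoint hdis, ← hcard A, ← hXY]
      ring
    have hsum := Finset.sum_le_sum_of_subset_of_nonneg hsub fun i hi _ => (hkpos i (hCA hi)).le
    rw [Finset.sum_union hdis, hsumX] at hsum
    refine le_trans ?_ hsum
    have hDs : ∑ j ∈ D A, k A j * y j = 2 ^ (supp α A).card - s A := by simp [s]
    rw [hDs]
    rw [hceq, pow_add] at hs1 ⊢
    exact le_even_share_add hU Y.card.cast_nonneg hC2.le hpow hs1
  · -- Besides `Y`, some further basis vector is missing in `C`.
    obtain ⟨j, hjD, hjC⟩ := Finset.not_subset.1 hDC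
    have hcle : (supp α C).card + Y.card + 1 ≤ (supp α A).card := by
      have hdis : Disjoint (supp α C) (insert j Y) := by
        rw [Finset.disjoint_insert_right]
        exact ⟨hjC, Finset.disjoint_right.2 fun i hi => (Finset.mem_filter.1 hi).2⟩
      have hjY : j ∉ Y := fun hj => (Finset.mem_filter.1 hjD).2
        (Finset.mem_filter.1 (Finset.mem_filter.1 hj).1).2
      rw [add_assoc, ← Finset.card_insert_of_notMem hjY, ← Finset.card_union_of_disjoint hdis]
      refine Finset.card_le_card (Finset.union_subset hCA (Finset.insert_subset
        (Finset.mem_filter.1 hjD).1 fun i hi =>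
          (Finset.mem_filter.1 (Finset.mem_filter.1 hi).1).1))
    have h1 : (2 : ℝ) ^ ((supp α C).card + Y.card + 1) ≤ 2 ^ (supp α A).card :=
      pow_le_pow_right₀ (by norm_num) hcle
    rw [pow_succ, pow_add] at h1
    refine le_trans ?_ (Finset.sum_le_sum_of_subset_of_nonneg hXC
      fun i hi _ => (hkpos i (hCA hi)).le)
    rw [hsumX, ← mul_div_assoc, le_div_iff₀ hU]
    have hX0 : (0 : ℝ) < X.card := by exact_mod_cast hX
    calc (2 : ℝ) ^ (supp α C).card * (X.card + Y.card)
        ≤ 2 ^ (supp α C).card * (2 ^ Y.card * X.card) := mul_le_mul_of_nonneg_left hpow hC2.le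
      _ = X.card * (2 ^ (supp α C).card * 2 ^ Y.card) := by ring
      _ ≤ X.card * s A := mul_le_mul_of_nonneg_left (by linarith) hX0.le

end Weights

/-! ### Simple roots and the coefficients of the projections of `δ` -/

section SimpleRoots

variable {V : Type*} [NormedAddCommGroup V] [InnerProductSpace ℝ V]
  {n : ℕ} {Φ : Finset V} {α : Module.Basis (Fin n) ℝ V} {G : Set (Submodule ℝ V)}
  {A B : Submodule ℝ V} {i j : Fin n}

lemma rootReflection_apply (β v : V) :
    rootReflection β v = v - (2 * (⟪β, v⟫_ℝ / ‖β‖ ^ 2)) • β := by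
  rw [rootReflection, Submodule.reflection_orthogonal_apply, Submodule.reflection_singleton_apply]
  simp only [RCLike.ofReal_real_eq_id, id_eq]
  module

lemma rootReflection_self (β : V) : rootReflection β β = -β :=
  Submodule.reflection_orthogonalComplement_singleton_eq_neg β

lemma rootReflection_rootReflection (β v : V) : rootReflection β (rootReflection β v) = v :=
  Submodule.reflection_reflection _ v

/-- The reflection in a simple root `α i` changes only the `i`-th coordinate. -/
lemma repr_rootReflection (v : V) (hij : j ≠ i) :
    α.repr (rootReflection (α i) v) j = α.repr v j := by
  rw [rootReflection_apply, map_sub, map_smul]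
  simp [hij.symm]

lemma inner_simple_nonpos (hΦ : IsRootSystem Φ) (hα : IsSimpleBasis Φ α) (hij : i ≠ j) :
    ⟪α i, α j⟫_ℝ ≤ 0 := by
  have hmem := hΦ.reflection_mem _ (hα.mem i) _ (hα.mem j)
  have hj : α.repr (rootReflection (α i) (α j)) j = 1 := by
    rw [repr_rootReflection _ hij.symm]; simp
  have hi : α.repr (rootReflection (α i) (α j)) i = -(2 * (⟪α i, α j⟫_ℝ / ‖α i‖ ^ 2)) := by
    rw [rootReflection_apply, map_sub, map_smul]
    simp [hij.symm]
  rcases hα.sign _ hmem with h | h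
  · have h1 := h i
    rw [hi] at h1
    have h2 : 0 < ‖α i‖ ^ 2 := by have := norm_pos_iff.2 (α.ne_zero i); positivity
    by_contra! hc
    have := div_pos hc h2
    linarith
  · have := h j
    rw [hj] at this
    linarith

/-- `δ` has positive scalar product with each simple root `α i`: the reflection in `α i` permutes
the positive roots other than `α i`, so that their sum is orthogonal to `α i`. -/
lemma inner_delta_pos (hΦ : IsRootSystem Φ) (hα : IsSimpleBasis Φ α) (i : Fin n) :
    0 < ⟪delta Φ α, α i⟫_ℝ := by
  classical
  set pos := Φ.filter (fun β => ∀ i, 0 ≤ α.repr β i) with hpos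
  have hi : α i ∈ pos := Finset.mem_filter.2 ⟨hα.mem i, fun j => by
    rw [α.repr_self, Finsupp.single_apply]; split_ifs <;> norm_num⟩
  have hmaps : ∀ β ∈ pos.erase (α i), rootReflection (α i) β ∈ pos.erase (α i) := by
    intro β hβ
    obtain ⟨hne, hβ⟩ := Finset.mem_erase.1 hβ
    obtain ⟨hβΦ, hβ0⟩ := Finset.mem_filter.1 hβ
    have hmem := hΦ.reflection_mem _ (hα.mem i) _ hβΦ
    -- As `β` is not a multiple of `α i`, it has another positive coordinate.
    obtain ⟨j, hji, hj⟩ : ∃ j, j ≠ i ∧ 0 < α.repr β j := by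
      by_contra! hc
      have h0 : ∀ j, j ≠ i → α.repr β j = 0 := fun j hj => le_antisymm (hc j hj) (hβ0 j)
      have hβi : β = α.repr β i • α i := by
        conv_lhs => rw [← α.sum_repr β]
        exact Finset.sum_eq_single i (fun j _ hj => by rw [h0 j hj, zero_smul]) (by simp)
      rcases hΦ.reduced _ (hα.mem i) (α.repr β i) (hβi ▸ hβΦ) with h1 | h1
      · rw [h1, one_smul] at hβi
        exact hne hβi
      · have := hβ0 i
        rw [h1] at this
        linarith
    refine Finset.mem_erase.2 ⟨fun he => ?_, Finset.mem_filter.2 ⟨hmem, ?_⟩⟩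
    · have h1 := repr_rootReflection (α := α) β hji
      rw [he, α.repr_self, Finsupp.single_apply, if_neg hji.symm] at h1
      exact hj.ne h1
    · rcases hα.sign _ hmem with h | h
      · exact h
      · have := h j
        rw [repr_rootReflection β hji] at this
        exact absurd this hj.not_ge
  have hsum : rootReflection (α i) (∑ β ∈ pos.erase (α i), β) = ∑ β ∈ pos.erase (α i), β := by
    rw [map_sum]
    exact Finset.sum_nbij' (fun β => rootReflection (α i) β) (fun β => rootReflection (α i) β)
      hmaps hmaps (fun β _ => rootReflection_rootReflection _ β)
      (fun β _ => rootReflection_rootReflection _ β) fun β _ => rfl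
  have h0 : ⟪∑ β ∈ pos.erase (α i), β, α i⟫_ℝ = 0 := by
    have h1 := (rootReflection (α i)).inner_map_map (∑ β ∈ pos.erase (α i), β) (α i)
    rw [hsum, rootReflection_self, inner_neg_right] at h1
    linarith
  have hd : delta Φ α = (1 / 2 : ℝ) • (α i + ∑ β ∈ pos.erase (α i), β) := by
    rw [Finset.add_sum_erase pos (fun β => β) hi]; rfl
  rw [hd, inner_smul_left, inner_add_left, h0, add_zero, real_inner_self_eq_norm_sq]
  have := norm_pos_iff.2 (α.ne_zero i)
  simp only [conj_trivial]
  positivity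

/-- A vector in the span of some simple roots that has nonnegative scalar products with these
roots has nonnegative coordinates, because distinct simple roots have nonpositive scalar
products. -/
lemma repr_nonneg_of_inner_nonneg (hΦ : IsRootSystem Φ) (hα : IsSimpleBasis Φ α) {v : V}
    (hv : ∀ i, α.repr v i = 0 ∨ 0 ≤ ⟪v, α i⟫_ℝ) (i : Fin n) : 0 ≤ α.repr v i := by
  set p : V := ∑ i, max (α.repr v i) 0 • α i
  set m : V := ∑ i, max (-α.repr v i) 0 • α i
  have hpm : v = p - m := by
    conv_lhs => rw [← α.sum_repr v]
    rw [← Finset.sum_sub_distrib]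
    refine Finset.sum_congr rfl fun i _ => ?_
    rw [← sub_smul]
    congr 1
    rcases le_total 0 (α.repr v i) with h | h
    · rw [max_eq_left h, max_eq_right (by linarith), sub_zero]
    · rw [max_eq_right h, max_eq_left (by linarith), zero_sub, neg_neg]
  have h1 : 0 ≤ ⟪v, m⟫_ℝ := by
    rw [inner_sum]
    refine Finset.sum_nonneg fun i _ => ?_
    rw [inner_smul_right]
    rcases hv i with h | h
    · simp [h]
    · exact mul_nonneg (le_max_right _ _) h
  have h2 : ⟪p, m⟫_ℝ ≤ 0 := by
    rw [sum_inner]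
    refine Finset.sum_nonpos fun i _ => ?_
    rw [inner_sum]
    refine Finset.sum_nonpos fun j _ => ?_
    rw [inner_smul_left, inner_smul_right, conj_trivial, ← mul_assoc]
    by_cases hij : i = j
    · subst hij
      rcases le_total 0 (α.repr v i) with h | h
      · rw [max_eq_right (a := -α.repr v i) (by linarith), mul_zero, zero_mul]
      · rw [max_eq_right h, zero_mul, zero_mul]
    · exact mul_nonpos_of_nonneg_of_nonpos (mul_nonneg (le_max_right _ _) (le_max_right _ _))
        (inner_simple_nonpos hΦ hα hij)
  have hm : m = 0 := by
    have : ⟪v, m⟫_ℝ = ⟪p, m⟫_ℝ - ⟪m, m⟫_ℝ := by rw [hpm, inner_sub_left]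
    exact inner_self_eq_zero.1 (le_antisymm (by linarith) real_inner_self_nonneg)
  have := Fintype.linearIndependent_iff.1 α.linearIndependent _ hm i
  have h3 := le_max_left (-α.repr v i) 0
  linarith

variable [FiniteDimensional ℝ V]

lemma inner_piVec (hi : α i ∈ A) : ⟪piVec Φ α A, α i⟫_ℝ = ⟪delta Φ α, α i⟫_ℝ := by
  rw [piVec, Submodule.inner_starProjection_left_eq_right,
    Submodule.starProjection_eq_self_iff.2 hi]

lemma piVec_top : piVec Φ α ⊤ = delta Φ α :=
  Submodule.starProjection_eq_self_iff.2 trivial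

variable {F : Set (Submodule ℝ V)}

lemma repr_piVec_eq_zero (h : IsCoordBuilding α F) (hA : A ∈ F) (hi : i ∉ supp α A) :
    α.repr (piVec Φ α A) i = 0 := by
  have hmem : piVec Φ α A ∈ A := Submodule.starProjection_apply_mem _ _
  have hspan : ∀ v ∈ A, ↑(α.repr v).support ⊆ (supp α A : Set (Fin n)) := fun v hv =>
    α.mem_span_image.1 (h.eq_span A hA ▸ hv)
  by_contra hc
  exact hi (hspan _ hmem (Finsupp.mem_support_iff.2 hc))

lemma repr_piVec_nonneg (hΦ : IsRootSystem Φ) (hα : IsSimpleBasis Φ α) (h : IsCoordBuilding α F)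
    (hA : A ∈ F) (i : Fin n) : 0 ≤ α.repr (piVec Φ α A) i := by
  refine repr_nonneg_of_inner_nonneg hΦ hα (fun i => ?_) i
  by_cases hi : i ∈ supp α A
  · exact Or.inr ((inner_piVec (mem_supp.1 hi)).ge.trans' (inner_delta_pos hΦ hα i).le)
  · exact Or.inl (repr_piVec_eq_zero h hA hi)

lemma repr_piVec_pos (hΦ : IsRootSystem Φ) (hα : IsSimpleBasis Φ α) (h : IsCoordBuilding α F)
    (hA : A ∈ F) (hi : i ∈ supp α A) : 0 < α.repr (piVec Φ α A) i := by
  refine (repr_piVec_nonneg hΦ hα h hA i).lt_of_ne fun h0 => ?_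
  have h1 := inner_delta_pos hΦ hα i
  rw [← inner_piVec (mem_supp.1 hi), ← α.sum_repr (piVec Φ α A), sum_inner] at h1
  refine h1.not_ge (Finset.sum_nonpos fun j _ => ?_)
  rw [inner_smul_left, conj_trivial]
  by_cases hji : j = i
  · rw [hji, ← h0, zero_mul]
  · exact mul_nonpos_of_nonneg_of_nonpos (repr_piVec_nonneg hΦ hα h hA j)
      (inner_simple_nonpos hΦ hα hji)

/-- The vector `w` is the part of `π_A` along the simple roots of `B ⊆ A`, minus `π_B`. As `π_A` and
`π_B` have the same scalar products with the simple roots of `B`, those of `w` come from the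
remaining part of `π_A`. -/
lemma exists_repr_eq_sub (h : IsCoordBuilding α F)
    (hB : B ∈ F) (hBA : B ≤ A) :
    ∃ w : V, (∀ i ∈ supp α B, α.repr w i = α.repr (piVec Φ α A) i - α.repr (piVec Φ α B) i) ∧
      (∀ i ∉ supp α B, α.repr w i = 0) ∧
      ∀ i ∈ supp α B, ⟪w, α i⟫_ℝ =
        -∑ j ∈ (supp α B)ᶜ, α.repr (piVec Φ α A) j * ⟪α j, α i⟫_ℝ := by
  classical
  set c := α.repr (piVec Φ α A)
  have hr : ∀ i, α.repr (∑ j ∈ supp α B, c j • α j) i = if i ∈ supp α B then c i else 0 := by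
    intro i
    rw [map_sum, Finsupp.finsetSum_apply]
    simp [Finsupp.single_apply]
  refine ⟨∑ j ∈ supp α B, c j • α j - piVec Φ α B, fun i hi => ?_, fun i hi => ?_, fun i hi => ?_⟩
  · rw [map_sub, Finsupp.sub_apply, hr, if_pos hi]
  · rw [map_sub, Finsupp.sub_apply, hr, if_neg hi, repr_piVec_eq_zero h hB hi, sub_zero]
  · have h1 : ⟪piVec Φ α A, α i⟫_ℝ = ⟪delta Φ α, α i⟫_ℝ :=
      inner_piVec (hBA (mem_supp.1 hi))
    rw [← α.sum_repr (piVec Φ α A), ← Finset.sum_add_sum_compl (supp α B), inner_add_left,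
      ← inner_piVec (mem_supp.1 hi)] at h1
    rw [inner_sub_left]
    have h2 : ⟪∑ j ∈ (supp α B)ᶜ, c j • α j, α i⟫_ℝ =
        ∑ j ∈ (supp α B)ᶜ, c j * ⟪α j, α i⟫_ℝ := by
      rw [sum_inner]
      exact Finset.sum_congr rfl fun j _ => by rw [inner_smul_left, conj_trivial]
    rw [← h2]
    linarith

lemma repr_piVec_mono (hΦ : IsRootSystem Φ) (hα : IsSimpleBasis Φ α) (h : IsCoordBuilding α F)
    (hA : A ∈ F) (hB : B ∈ F) (hBA : B ≤ A) (hi : i ∈ supp α B) :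
    α.repr (piVec Φ α B) i ≤ α.repr (piVec Φ α A) i := by
  obtain ⟨w, hw1, hw0, hw⟩ := exists_repr_eq_sub h hB hBA
  have := repr_nonneg_of_inner_nonneg hΦ hα (v := w) (fun i => ?_) i
  · rw [hw1 i hi] at this
    linarith
  · by_cases hi : i ∈ supp α B
    · right
      rw [hw i hi, neg_nonneg]
      refine Finset.sum_nonpos fun j hj => mul_nonpos_of_nonneg_of_nonpos
        (repr_piVec_nonneg hΦ hα h hA j) (inner_simple_nonpos hΦ hα ?_)
      rintro rfl
      exact Finset.mem_compl.1 hj hi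
    · exact Or.inl (hw0 i hi)

/-- If the simple roots of `A` that are not in `B` are orthogonal to `B`, then `π_A` and `π_B` have
the same coefficients at the simple roots of `B`. -/
lemma repr_piVec_eq_of_orthogonal (hΦ : IsRootSystem Φ) (hα : IsSimpleBasis Φ α)
    (h : IsCoordBuilding α F) (hA : A ∈ F) (hB : B ∈ F) (hBA : B ≤ A)
    (ho : ∀ p ∈ supp α A, p ∉ supp α B → ∀ q ∈ supp α B, ⟪α p, α q⟫_ℝ = 0)
    (hi : i ∈ supp α B) : α.repr (piVec Φ α A) i = α.repr (piVec Φ α B) i := by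
  obtain ⟨w, hw1, hw0, hw⟩ := exists_repr_eq_sub h hB hBA
  refine le_antisymm ?_ (repr_piVec_mono hΦ hα h hA hB hBA hi)
  have := repr_nonneg_of_inner_nonneg hΦ hα (v := -w) (fun i => ?_) i
  · rw [map_neg, Finsupp.neg_apply, hw1 i hi] at this
    linarith
  · by_cases hi : i ∈ supp α B
    · right
      rw [inner_neg_left, hw i hi, neg_neg]
      refine (Finset.sum_eq_zero fun j hj => ?_).ge
      by_cases hjA : j ∈ supp α A
      · rw [ho j hjA (Finset.mem_compl.1 hj) i hi, mul_zero]
      · rw [repr_piVec_eq_zero h hA hjA, zero_mul]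
    · left
      rw [map_neg, Finsupp.neg_apply, hw0 i hi, neg_zero]

end SimpleRoots

/-! ### Building sets and simple roots -/

section BuildingSets

variable {V : Type*} [NormedAddCommGroup V] [InnerProductSpace ℝ V]
  {n : ℕ} {Φ : Finset V} {α : Module.Basis (Fin n) ℝ V} {G : Set (Submodule ℝ V)}
  {A B C M N : Submodule ℝ V} {i : Fin n}

lemma maximalBelow_mem (hM : M ∈ maximalBelow G C) : M ∈ G :=
  (show Maximal (fun U => U ∈ G ∧ U ≤ C) M from hM).prop.1

lemma maximalBelow_le (hM : M ∈ maximalBelow G C) : M ≤ C :=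
  (show Maximal (fun U => U ∈ G ∧ U ≤ C) M from hM).prop.2

lemma sup_mem_sumClosure {𝒜 : Set (Submodule ℝ V)} (hA : A ∈ sumClosure 𝒜)
    (hB : B ∈ sumClosure 𝒜) : A ⊔ B ∈ sumClosure 𝒜 := by
  obtain ⟨S, hS, hSne, rfl⟩ := hA
  obtain ⟨T, hT, -, rfl⟩ := hB
  exact ⟨S ∪ T, Set.union_subset hS hT, hSne.inl, sSup_union⟩

lemma span_mem (hG : IsBuildingSet (rootLines Φ) G) {β : V} (hβ : β ∈ Φ) :
    Submodule.span ℝ {β} ∈ G :=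
  hG.lines_subset ⟨β, hβ, rfl⟩

lemma supp_span_simple : supp α (Submodule.span ℝ {α i}) = {i} := by
  ext j
  rw [← Set.image_singleton, mem_supp_span]
  simp

lemma span_simple_mem_fund (hα : IsSimpleBasis Φ α) (hG : IsBuildingSet (rootLines Φ) G)
    (i : Fin n) : Submodule.span ℝ {α i} ∈ fund α G :=
  ⟨span_mem hG (hα.mem i), {i}, by rw [Set.image_singleton]⟩

/-- Two maximal elements of a building set below `C` that have a common nonzero vector coincide. -/
lemma eq_of_mem_maximalBelow (hG : IsBuildingSet (rootLines Φ) G)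
    (hC : C ∈ sumClosure (rootLines Φ)) (hM : M ∈ maximalBelow G C) (hN : N ∈ maximalBelow G C)
    {v : V} (hv : v ≠ 0) (hvM : v ∈ M) (hvN : v ∈ N) : M = N := by
  by_contra hne
  have h1 := (hG.independent C hC hM).mono_right
    (le_sSup (show N ∈ _ \ {M} from ⟨hN, fun e => hne e.symm⟩))
  exact hv (Submodule.disjoint_def.1 h1 v hvM hvN)

variable [FiniteDimensional ℝ V]

lemma exists_maximalBelow (hA : A ∈ G) (hAC : A ≤ C) :
    ∃ M ∈ maximalBelow G C, A ≤ M := by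
  obtain ⟨M, hAM, hM⟩ := exists_maximal_ge_of_wellFoundedGT (fun U => U ∈ G ∧ U ≤ C) A ⟨hA, hAC⟩
  exact ⟨M, hM, hAM⟩

lemma sup_mem_of_mem_inf (hG : IsBuildingSet (rootLines Φ) G) (hA : A ∈ G) (hB : B ∈ G) {v : V}
    (hv : v ≠ 0) (hvA : v ∈ A) (hvB : v ∈ B) : A ⊔ B ∈ G := by
  have hC := sup_mem_sumClosure (hG.subset_sumClosure hA) (hG.subset_sumClosure hB)
  obtain ⟨M, hM, hAM⟩ := exists_maximalBelow (C := A ⊔ B) hA le_sup_left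
  obtain ⟨N, hN, hBN⟩ := exists_maximalBelow (C := A ⊔ B) hB le_sup_right
  obtain rfl := eq_of_mem_maximalBelow hG hC hM hN hv (hAM hvA) (hBN hvB)
  rw [← (maximalBelow_le hM).antisymm (sup_le hAM hBN)]
  exact maximalBelow_mem hM

/-- A building set contains with `B` also the span of `B` and a root that is not orthogonal to some
root `γ` in `B`. Otherwise the root obtained from it by reflection in `γ` would lie in no maximal
element below that span. -/
lemma sup_span_mem (hΦ : IsRootSystem Φ) (hG : IsBuildingSet (rootLines Φ) G) (hB : B ∈ G)
    {β γ : V} (hβ : β ∈ Φ) (hγ : γ ∈ Φ) (hγB : γ ∈ B) (hβγ : ⟪γ, β⟫_ℝ ≠ 0) :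
    B ⊔ Submodule.span ℝ {β} ∈ G := by
  have hγ0 : γ ≠ 0 := fun e => hΦ.zero_notMem (e ▸ hγ)
  have hβ0 : β ≠ 0 := fun e => hΦ.zero_notMem (e ▸ hβ)
  have hρ := hΦ.reflection_mem γ hγ β hβ
  set ρ := rootReflection γ β with hρdef
  have hρ0 : ρ ≠ 0 := fun e => hΦ.zero_notMem (e ▸ hρ)
  set r := 2 * (⟪γ, β⟫_ℝ / ‖γ‖ ^ 2)
  have hr : r ≠ 0 := by
    have := norm_ne_zero_iff.2 hγ0
    exact mul_ne_zero two_ne_zero (div_ne_zero hβγ (pow_ne_zero 2 this))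
  have hρβ : ρ = β - r • γ := rootReflection_apply γ β
  have hC := sup_mem_sumClosure (hG.subset_sumClosure hB) (hG.subset_sumClosure (span_mem hG hβ))
  set C := B ⊔ Submodule.span ℝ {β} with hCdef
  have hβC : β ∈ C := (le_sup_right : _ ≤ C) (Submodule.mem_span_singleton_self β)
  have hρC : ρ ∈ C := hρβ ▸ C.sub_mem hβC (C.smul_mem r ((le_sup_left : B ≤ C) hγB))
  obtain ⟨M, hM, hBM⟩ := exists_maximalBelow (C := C) hB le_sup_left
  obtain ⟨N, hN, hβN⟩ := exists_maximalBelow (C := C) (span_mem hG hβ) le_sup_right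
  obtain ⟨P, hP, hρP⟩ := exists_maximalBelow (C := C) (span_mem hG hρ)
    ((Submodule.span_singleton_le_iff_mem _ _).2 hρC)
  rw [Submodule.span_singleton_le_iff_mem] at hβN hρP
  suffices hMN : β ∈ M by
    have : M = C := (maximalBelow_le hM).antisymm
      (sup_le hBM ((Submodule.span_singleton_le_iff_mem _ _).2 hMN))
    exact this ▸ maximalBelow_mem hM
  by_cases hPM : P = M
  · have h1 : β = ρ + r • γ := by rw [hρβ]; abel
    rw [h1]
    exact M.add_mem (hPM ▸ hρP) (M.smul_mem r (hBM hγB))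
  by_cases hPN : P = N
  · have h1 : r • γ ∈ N := by
      have : r • γ = β - ρ := by rw [hρβ]; abel
      rw [this]
      exact N.sub_mem hβN (hPN ▸ hρP)
    have h2 : γ ∈ N := (N.smul_mem_iff hr).1 h1
    rwa [eq_of_mem_maximalBelow hG hC hM hN hγ0 (hBM hγB) h2]
  · exfalso
    have h1 : M ⊔ N ≤ sSup (maximalBelow G C \ {P}) :=
      sup_le (le_sSup ⟨hM, fun e => hPM e.symm⟩) (le_sSup ⟨hN, fun e => hPN e.symm⟩)
    have h2 : ρ ∈ M ⊔ N := hρβ ▸ (M ⊔ N).sub_mem ((le_sup_right : N ≤ _) hβN)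
      ((M ⊔ N).smul_mem r ((le_sup_left : M ≤ _) (hBM hγB)))
    exact hρ0 (Submodule.disjoint_def.1 (hG.independent C hC hP) ρ hρP (h1 h2))

lemma isCoordBuilding_fund (hΦ : IsRootSystem Φ) (hG : IsBuildingSet (rootLines Φ) G)
    (hGV : (⊤ : Submodule ℝ V) ∈ G) : IsCoordBuilding α (fund α G) where
  eq_span := by
    rintro _ ⟨-, I, rfl⟩
    exact span_image_supp
  bot_notMem := by
    rintro ⟨hbot, -⟩
    obtain ⟨T, hT, ⟨L, hL⟩, h0⟩ := hG.subset_sumClosure hbot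
    obtain ⟨β, hβ, rfl⟩ := hT hL
    have h1 : Submodule.span ℝ {β} = ⊥ := le_bot_iff.1 (h0 ▸ le_sSup hL)
    exact hΦ.zero_notMem (Submodule.span_singleton_eq_bot.1 h1 ▸ hβ)
  top_mem := ⟨hGV, Set.univ, by rw [Set.image_univ, α.span_eq]⟩
  sup_mem := by
    rintro A ⟨hA, I, hI⟩ B ⟨hB, J, hJ⟩ hd
    obtain ⟨i, hiA, hiB⟩ := Finset.not_disjoint_iff.1 hd
    refine ⟨sup_mem_of_mem_inf hG hA hB (α.ne_zero i) (mem_supp.1 hiA) (mem_supp.1 hiB), I ∪ J, ?_⟩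
    rw [hI, hJ, Set.image_union, Submodule.span_union]

lemma sup_span_simple_mem_fund (hΦ : IsRootSystem Φ) (hα : IsSimpleBasis Φ α)
    (hG : IsBuildingSet (rootLines Φ) G) (hB : B ∈ fund α G) {p q : Fin n} (hq : q ∈ supp α B)
    (hpq : ⟪α p, α q⟫_ℝ ≠ 0) : B ⊔ Submodule.span ℝ {α p} ∈ fund α G := by
  refine ⟨sup_span_mem hΦ hG hB.1 (hα.mem p) (hα.mem q) (mem_supp.1 hq)
    (by rwa [real_inner_comm]), ?_⟩
  obtain ⟨-, I, rfl⟩ := hB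
  exact ⟨I ∪ {p}, by rw [Set.image_union, Submodule.span_union, Set.image_singleton]⟩

end BuildingSets

/-! ### Scalar products with a basis as coordinates -/

section Coordinates

variable {V : Type*} [NormedAddCommGroup V] [InnerProductSpace ℝ V] {n : ℕ}
  {α : Module.Basis (Fin n) ℝ V}

/-- The scalar products with the basis vectors as linear coordinates. -/
def innerCoords (α : Module.Basis (Fin n) ℝ V) : V →ₗ[ℝ] Fin n → ℝ :=
  LinearMap.pi fun i => (innerSL ℝ (α i)).toLinearMap

lemma innerCoords_apply (x : V) (i : Fin n) : innerCoords α x i = ⟪x, α i⟫_ℝ :=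
  real_inner_comm _ _

lemma ker_innerCoords : LinearMap.ker (innerCoords α) = ⊥ := by
  rw [LinearMap.ker_eq_bot']
  intro x hx
  refine InnerProductSpace.ext_inner_right_basis α fun i => ?_
  rw [← innerCoords_apply, hx, inner_zero_left]
  rfl

lemma exists_inner_eq [FiniteDimensional ℝ V] (y : Fin n → ℝ) : ∃ x : V, ∀ i, ⟪x, α i⟫_ℝ = y i := by
  have hs : Function.Surjective (innerCoords α) :=
    (LinearMap.injective_iff_surjective_of_finrank_eq_finrank (by
      rw [Module.finrank_eq_card_basis α, Module.finrank_fin_fun, Fintype.card_fin])).1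
      (LinearMap.ker_eq_bot.1 ker_innerCoords)
  obtain ⟨x, hx⟩ := hs y
  exact ⟨x, fun i => by rw [← innerCoords_apply, hx]⟩

end Coordinates

/-! ### Suitable lists -/

section Suitable

variable {V : Type*} [NormedAddCommGroup V] [InnerProductSpace ℝ V] [FiniteDimensional ℝ V]
  {n : ℕ} {Φ : Finset V} {α : Module.Basis (Fin n) ℝ V} {G : Set (Submodule ℝ V)}
  {A B : Submodule ℝ V} {i : Fin n} {ε : ℕ → ℝ}

lemma finite_piCoeffs : (piCoeffs Φ α A).Finite :=
  (Set.finite_range fun i => α.repr (piVec Φ α A) i).subset fun _ ⟨i, _, hc⟩ => ⟨i, hc.symm⟩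

lemma repr_piVec_mem_piCoeffs (hi : i ∈ supp α A) : α.repr (piVec Φ α A) i ∈ piCoeffs Φ α A :=
  ⟨i, mem_supp.1 hi, rfl⟩

lemma repr_piVec_le_ratio_mul (hΦ : IsRootSystem Φ) (hα : IsSimpleBasis Φ α)
    {F : Set (Submodule ℝ V)} (h : IsCoordBuilding α F) (hA : A ∈ F) (hB : B ∈ F) (hBA : B ≤ A)
    (hi : i ∈ supp α B) :
    α.repr (piVec Φ α A) i ≤ ratio Φ α A B * α.repr (piVec Φ α B) i := by
  have hiA := supp_mono hBA hi
  have h1 := le_csSup finite_piCoeffs.bddAbove (repr_piVec_mem_piCoeffs (Φ := Φ) hiA)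
  have h2 := csInf_le finite_piCoeffs.bddBelow (repr_piVec_mem_piCoeffs (Φ := Φ) hi)
  have h3 : 0 < sInf (piCoeffs Φ α B) := by
    obtain ⟨j, hj, he⟩ := Set.Nonempty.csInf_mem
      ⟨_, repr_piVec_mem_piCoeffs (Φ := Φ) hi⟩ finite_piCoeffs
    rw [he]
    exact repr_piVec_pos hΦ hα h hB (mem_supp.2 hj)
  have h4 := (repr_piVec_pos hΦ hα h hA hiA).le.trans h1
  calc α.repr (piVec Φ α A) i ≤ sSup (piCoeffs Φ α A) := h1
    _ = ratio Φ α A B * sInf (piCoeffs Φ α B) := by rw [ratio, div_mul_cancel₀ _ h3.ne']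
    _ ≤ _ := mul_le_mul_of_nonneg_left h2 (div_nonneg h4 h3.le)

lemma one_le_ratio (hΦ : IsRootSystem Φ) (hα : IsSimpleBasis Φ α)
    {F : Set (Submodule ℝ V)} (h : IsCoordBuilding α F) (hA : A ∈ F) (hB : B ∈ F) (hBA : B ≤ A) :
    1 ≤ ratio Φ α A B := by
  obtain ⟨i, hi⟩ := h.supp_nonempty hB
  have h1 := repr_piVec_mono hΦ hα h hA hB hBA hi
  have h2 := repr_piVec_le_ratio_mul hΦ hα h hA hB hBA hi
  have h3 := repr_piVec_pos hΦ hα h hB hi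
  exact le_of_mul_le_mul_right (by linarith) h3

lemma ratio_le_maxRatio (h : IsCoordBuilding α (fund α G)) (hA : A ∈ fund α G)
    (hB : B ∈ fund α G) (hBA : B < A) :
    ratio Φ α A B ≤ maxRatio Φ α G (supp α A).card (supp α B).card := by
  have hmem : ratio Φ α A B ∈ ratios Φ α G (supp α A).card (supp α B).card :=
    ⟨A, hA, B, hB, hBA, h.finrank_eq hA, h.finrank_eq hB, rfl⟩
  have hfin : (ratios Φ α G (supp α A).card (supp α B).card).Finite :=
    (h.finite.image2 (ratio Φ α) h.finite).subset fun r ⟨A, hA, B, hB, _, _, _, hr⟩ =>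
      ⟨A, hA, B, hB, hr.symm⟩
  rw [maxRatio, if_pos ⟨_, hmem⟩]
  exact le_csSup hfin.bddAbove hmem

lemma one_le_maxRatio (hΦ : IsRootSystem Φ) (hα : IsSimpleBasis Φ α)
    (h : IsCoordBuilding α (fund α G)) (k l : ℕ) : 1 ≤ maxRatio Φ α G k l := by
  by_cases hne : (ratios Φ α G k l).Nonempty
  · obtain ⟨_, A, hA, B, hB, hBA, rfl, rfl, rfl⟩ := hne
    have := (one_le_ratio hΦ hα h hA hB hBA.le).trans (ratio_le_maxRatio h hA hB hBA)
    rwa [h.finrank_eq hA, h.finrank_eq hB]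
  · rw [maxRatio, if_neg hne]

lemma suitable_pos (h : IsCoordBuilding α (fund α G)) (hε : IsSuitable Φ α G ε)
    (hA : A ∈ fund α G) : 0 < ε (supp α A).card :=
  hε.pos _ (h.supp_nonempty hA).card_pos (card_supp_le A)

/-- A suitable list more than doubles in each step, because every `R^i_j` is at least `1`. -/
lemma suitable_mul_two_pow_lt (hΦ : IsRootSystem Φ) (hα : IsSimpleBasis Φ α)
    (h : IsCoordBuilding α (fund α G)) (hε : IsSuitable Φ α G ε) {k l : ℕ} (hk : 1 ≤ k)
    (hkl : k < l) (hl : l ≤ n) : ε k * 2 ^ l < ε l * 2 ^ k := by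
  have hstep : ∀ m, 1 ≤ m → m + 1 ≤ n → 2 * ε m < ε (m + 1) := by
    intro m hm hmn
    have h1 := hε.suitable (m + 1) (by omega) hmn
    have h2 := one_le_maxRatio hΦ hα h (m + 1) m
    have h3 := hε.pos m hm (by omega)
    rw [Nat.add_sub_cancel] at h1
    nlinarith
  induction l, hkl using Nat.le_induction with
  | base =>
    rw [pow_succ]
    have := mul_lt_mul_of_pos_right (hstep k hk hl) (show (0 : ℝ) < 2 ^ k by positivity)
    linarith
  | succ l hkl ih =>
    have h1 := ih (by omega)
    have h2 := mul_lt_mul_of_pos_right (hstep l (by omega) hl) (show (0 : ℝ) < 2 ^ k by positivity)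
    rw [pow_succ]
    linarith

/-- For `B ⊂ A`, the coefficients of `π_A`, divided by `ε_{dim A} / 2 ^ dim A`, are smaller than the
correspondingly rescaled coefficients of `π_B`. To reach `A` from `B`, one adds simple roots
one at a time as long as some simple root of `A` is not orthogonal to the subspace reached so far;
the subspaces obtained in this way lie in `G_fund`, and each step is controlled by the suitability
of the list. When only orthogonal simple roots remain, the coefficients do not change any more. -/
lemma repr_piVec_mul_lt (hΦ : IsRootSystem Φ) (hα : IsSimpleBasis Φ α)
    (hG : IsBuildingSet (rootLines Φ) G) (h : IsCoordBuilding α (fund α G))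
    (hε : IsSuitable Φ α G ε) (hA : A ∈ fund α G) (hB : B ∈ fund α G) (hBA : B < A)
    (hi : i ∈ supp α B) :
    α.repr (piVec Φ α A) i * ε (supp α B).card * 2 ^ (supp α A).card <
      α.repr (piVec Φ α B) i * ε (supp α A).card * 2 ^ (supp α B).card := by
  classical
  induction hm : (supp α A).card - (supp α B).card using Nat.strong_induction_on
    generalizing B with
  | _ m ih =>
  have hcBA := h.card_lt_card hA hBA
  have hcB := (h.supp_nonempty hB).card_pos
  have hB0 := repr_piVec_pos hΦ hα h hB hi
  by_cases ho : ∀ p ∈ supp α A, p ∉ supp α B → ∀ q ∈ supp α B, ⟪α p, α q⟫_ℝ = 0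
  · rw [repr_piVec_eq_of_orthogonal hΦ hα h hA hB hBA.le ho hi, mul_assoc, mul_assoc]
    exact mul_lt_mul_of_pos_left (suitable_mul_two_pow_lt hΦ hα h hε hcB hcBA (card_supp_le A)) hB0
  · -- Otherwise, `B` is enlarged by one simple root `α p`, which raises its dimension by one.
    push Not at ho
    obtain ⟨p, hpA, hpB, q, hq, hpq⟩ := ho
    have hC := sup_span_simple_mem_fund hΦ hα hG hB hq hpq
    set C := B ⊔ Submodule.span ℝ {α p} with hCdef
    have hpC : p ∈ supp α C := supp_mono le_sup_right (by rw [supp_span_simple]; simp)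
    have hBC : B < C := le_sup_left.lt_of_not_ge fun hle => hpB (supp_mono hle hpC)
    have hcC : (supp α C).card = (supp α B).card + 1 := by
      rw [hCdef, h.supp_sup hB (span_simple_mem_fund hα hG p), supp_span_simple,
        Finset.card_union_of_disjoint (by simpa using hpB), Finset.card_singleton]
    have hCA : C ≤ A :=
      sup_le hBA.le ((Submodule.span_singleton_le_iff_mem _ _).2 (mem_supp.1 hpA))
    have hεB := suitable_pos h hε hB
    have hεC := suitable_pos h hε hC
    have h2B : (0 : ℝ) < 2 ^ (supp α B).card := by positivity
    have hstep : α.repr (piVec Φ α C) i * ε (supp α B).card * 2 <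
        α.repr (piVec Φ α B) i * ε (supp α C).card := by
      have h1 := repr_piVec_le_ratio_mul hΦ hα h hC hB hBC.le hi
      have h2 := ratio_le_maxRatio (Φ := Φ) h hC hB hBC
      have h3 := hε.suitable (supp α C).card (by omega) (card_supp_le C)
      have h4 : (supp α C).card - 1 = (supp α B).card := by omega
      rw [h4] at h3
      calc α.repr (piVec Φ α C) i * ε (supp α B).card * 2
          ≤ (maxRatio Φ α G (supp α C).card (supp α B).card * α.repr (piVec Φ α B) i) *
              ε (supp α B).card * 2 := by
            gcongr
            exact h1.trans (mul_le_mul_of_nonneg_right h2 hB0.le)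
        _ = α.repr (piVec Φ α B) i *
            (2 * maxRatio Φ α G (supp α C).card (supp α B).card * ε (supp α B).card) := by ring
        _ < _ := mul_lt_mul_of_pos_left h3 hB0
    rcases hCA.eq_or_lt with heq | hlt
    · rw [← heq]
      have := mul_lt_mul_of_pos_right hstep h2B
      calc _ = α.repr (piVec Φ α C) i * ε (supp α B).card * 2 * 2 ^ (supp α B).card := by
            rw [hcC, pow_succ]; ring
        _ < _ := this
    · have h1 := ih _ (by have := h.card_lt_card hA hlt; omega) hC hlt (supp_mono hBC.le hi) rfl
      have hεA := suitable_pos h hε hA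
      refine lt_of_mul_lt_mul_right ?_ hεC.le
      calc α.repr (piVec Φ α A) i * ε (supp α B).card * 2 ^ (supp α A).card * ε (supp α C).card
          = (α.repr (piVec Φ α A) i * ε (supp α C).card * 2 ^ (supp α A).card) *
              ε (supp α B).card := by ring
        _ < (α.repr (piVec Φ α C) i * ε (supp α A).card * 2 ^ (supp α C).card) *
              ε (supp α B).card := mul_lt_mul_of_pos_right h1 hεB
        _ = (α.repr (piVec Φ α C) i * ε (supp α B).card * 2) *
              (ε (supp α A).card * 2 ^ (supp α B).card) := by rw [hcC, pow_succ]; ring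
        _ < (α.repr (piVec Φ α B) i * ε (supp α C).card) *
              (ε (supp α A).card * 2 ^ (supp α B).card) :=
            mul_lt_mul_of_pos_right hstep (mul_pos hεA h2B)
        _ = _ := by ring

/-- The coefficients of `π_A`, rescaled so that the inequality of `A` bounds the weighted sum of
the scalar products with the simple roots from below by `2 ^ dim A`. -/
def weight (Φ : Finset V) (α : Module.Basis (Fin n) ℝ V) (ε : ℕ → ℝ) (A : Submodule ℝ V)
    (i : Fin n) : ℝ :=
  α.repr (piVec Φ α A) i * 2 ^ (supp α A).card / ε (supp α A).card

lemma isDecreasingWeight_weight (hΦ : IsRootSystem Φ) (hα : IsSimpleBasis Φ α)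
    (hG : IsBuildingSet (rootLines Φ) G) (h : IsCoordBuilding α (fund α G))
    (hε : IsSuitable Φ α G ε) : IsDecreasingWeight α (fund α G) (weight Φ α ε) where
  pos A hA i hi := by
    have h1 := repr_piVec_pos hΦ hα h hA hi
    have h2 := suitable_pos h hε hA
    unfold weight
    positivity
  lt A hA B hB hBA i hi := by
    rw [weight, weight, div_lt_div_iff₀ (suitable_pos h hε hA) (suitable_pos h hε hB)]
    have := repr_piVec_mul_lt hΦ hα hG h hε hA hB hBA hi
    linarith

/-! ### The nestohedron as a polyhedron -/

/-- The linear functional of the inequality `(x, π_A) ≥ ε_{dim A}`, which on `H_V` is equivalent to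
the one defining `HS_A`. -/
def piFunctional (Φ : Finset V) (α : Module.Basis (Fin n) ℝ V) (A : Submodule ℝ V) :
    StrongDual ℝ V :=
  innerSL ℝ (piVec Φ α A)

lemma piFunctional_apply (A : Submodule ℝ V) (x : V) :
    piFunctional Φ α A x = ⟪piVec Φ α A, x⟫_ℝ := rfl

lemma piFunctional_eq (h : IsCoordBuilding α (fund α G))
    (hA : A ∈ fund α G) (x : V) :
    piFunctional Φ α A x * 2 ^ (supp α A).card / ε (supp α A).card =
      weightedSum α (weight Φ α ε) A fun i => ⟪x, α i⟫_ℝ := by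
  have h1 : piFunctional Φ α A x = ∑ i ∈ supp α A, α.repr (piVec Φ α A) i * ⟪x, α i⟫_ℝ := by
    rw [piFunctional_apply]
    conv_lhs => rw [← α.sum_repr (piVec Φ α A)]
    rw [sum_inner, ← Finset.sum_subset (Finset.subset_univ (supp α A))]
    · refine Finset.sum_congr rfl fun i _ => ?_
      rw [inner_smul_left, conj_trivial, real_inner_comm]
    · intro i _ hi
      rw [repr_piVec_eq_zero h hA hi, zero_smul, inner_zero_left]
  rw [h1, weightedSum, Finset.sum_mul, Finset.sum_div]
  refine Finset.sum_congr rfl fun i _ => ?_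
  rw [weight]
  ring

lemma two_pow_le_weightedSum_iff (h : IsCoordBuilding α (fund α G)) (hε : IsSuitable Φ α G ε)
    (hA : A ∈ fund α G) (x : V) :
    2 ^ (supp α A).card ≤ weightedSum α (weight Φ α ε) A (fun i => ⟪x, α i⟫_ℝ) ↔
      ε (Module.finrank ℝ A) ≤ piFunctional Φ α A x := by
  rw [← piFunctional_eq h hA, h.finrank_eq hA, le_div_iff₀ (suitable_pos h hε hA), mul_comm]
  exact mul_le_mul_iff_left₀ (by positivity)

lemma weightedSum_eq_two_pow_iff (h : IsCoordBuilding α (fund α G)) (hε : IsSuitable Φ α G ε)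
    (hA : A ∈ fund α G) (x : V) :
    weightedSum α (weight Φ α ε) A (fun i => ⟪x, α i⟫_ℝ) = 2 ^ (supp α A).card ↔
      piFunctional Φ α A x = ε (Module.finrank ℝ A) := by
  rw [← piFunctional_eq h hA, h.finrank_eq hA, div_eq_iff (suitable_pos h hε hA).ne',
    mul_comm (2 ^ _)]
  exact mul_left_inj' (by positivity)

lemma deltaVec_top : deltaVec Φ α ⊤ = delta Φ α := if_pos rfl

lemma deltaVec_of_ne (hA : A ≠ ⊤) : deltaVec Φ α A = delta Φ α - piVec Φ α A := by
  rw [deltaVec, if_neg hA, Submodule.starProjection_orthogonal_val, piVec]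

lemma mem_hyperplane_top {x : V} :
    x ∈ hyperplane Φ α ε ⊤ ↔
      piFunctional Φ α ⊤ x = ε (Module.finrank ℝ (⊤ : Submodule ℝ V)) := by
  rw [finrank_top_eq α, piFunctional_apply, piVec_top, real_inner_comm]
  simp [hyperplane, deltaVec_top, level]

/-- On `H_V`, the equation of `H_A` reads `(x, π_A) = ε_{dim A}`. -/
lemma mem_hyperplane_iff {x : V} (hx : x ∈ hyperplane Φ α ε ⊤) :
    x ∈ hyperplane Φ α ε A ↔ piFunctional Φ α A x = ε (Module.finrank ℝ A) := by
  by_cases hA : A = ⊤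
  · subst hA
    exact mem_hyperplane_top
  · have h1 : ⟪x, delta Φ α⟫_ℝ = ε n := by simpa [hyperplane, deltaVec_top, level] using hx
    rw [hyperplane, Set.mem_ofPred_eq, deltaVec_of_ne hA, inner_sub_right, h1, level, if_neg hA,
      piFunctional_apply, real_inner_comm, sub_right_inj]

lemma mem_halfSpace_iff {x : V} (hx : x ∈ hyperplane Φ α ε ⊤) (hA : A ≠ ⊤) :
    x ∈ halfSpace Φ α ε A ↔ ε (Module.finrank ℝ A) ≤ piFunctional Φ α A x := by
  have h1 : ⟪x, delta Φ α⟫_ℝ = ε n := by simpa [hyperplane, deltaVec_top, level] using hx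
  rw [halfSpace, Set.mem_ofPred_eq, deltaVec_of_ne hA, inner_sub_right, h1, level, if_neg hA,
    piFunctional_apply, real_inner_comm, sub_le_sub_iff_left]

lemma nestohedron_eq_polyhedron :
    nestohedron Φ α G ε =
      polyhedron (fund α G) ⊤ (piFunctional Φ α) fun A => ε (Module.finrank ℝ A) := by
  ext x
  rw [nestohedron, Set.mem_inter_iff]
  change _ ↔ piFunctional Φ α ⊤ x = ε (Module.finrank ℝ (⊤ : Submodule ℝ V)) ∧ _
  rw [← mem_hyperplane_top]
  refine and_congr_right fun hx => ?_
  rw [Set.mem_iInter₂]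
  refine ⟨fun hx' A hA => ?_, fun hx' A hA => (mem_halfSpace_iff hx hA.2).2 (hx' A hA.1)⟩
  by_cases hA' : A = ⊤
  · subst hA'
    exact (mem_hyperplane_top.1 hx).ge
  · exact (mem_halfSpace_iff hx hA').1 (hx' A ⟨hA, hA'⟩)

lemma inner_pos_of_mem_nestohedron (hΦ : IsRootSystem Φ) (hα : IsSimpleBasis Φ α)
    (hG : IsBuildingSet (rootLines Φ) G) (h : IsCoordBuilding α (fund α G))
    (hε : IsSuitable Φ α G ε) {x : V} (hx : x ∈ nestohedron Φ α G ε) (i : Fin n) :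
    0 < ⟪x, α i⟫_ℝ := by
  rw [nestohedron_eq_polyhedron] at hx
  have hL := span_simple_mem_fund hα hG i
  have hi : i ∈ supp α (Submodule.span ℝ {α i}) := by simp [supp_span_simple]
  have h1 := (two_pow_le_weightedSum_iff h hε hL x).2 (hx.2 _ hL)
  have h2 := (isDecreasingWeight_weight hΦ hα hG h hε).pos _ hL i hi
  rw [weightedSum, supp_span_simple, Finset.sum_singleton] at h1
  exact pos_of_mul_pos_right (lt_of_lt_of_le (by positivity) h1) h2.le

lemma isCompact_nestohedron (hΦ : IsRootSystem Φ) (hα : IsSimpleBasis Φ α)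
    (hG : IsBuildingSet (rootLines Φ) G) (h : IsCoordBuilding α (fund α G))
    (hε : IsSuitable Φ α G ε) : IsCompact (nestohedron Φ α G ε) := by
  have hclosed : IsClosed (nestohedron Φ α G ε) := by
    rw [nestohedron_eq_polyhedron]; exact isClosed_polyhedron
  have hw := isDecreasingWeight_weight hΦ hα hG h hε
  have hbox : IsCompact (innerCoords α ⁻¹'
      Set.Icc 0 fun i => (2 : ℝ) ^ (supp α (⊤ : Submodule ℝ V)).card / weight Φ α ε ⊤ i) :=
    (LinearMap.isClosedEmbedding_of_injective ker_innerCoords).isCompact_preimage isCompact_Icc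
  refine hbox.of_isClosed_subset hclosed fun x hx => ?_
  have hpos := inner_pos_of_mem_nestohedron hΦ hα hG h hε hx
  rw [nestohedron_eq_polyhedron] at hx
  have hsum := (weightedSum_eq_two_pow_iff h hε h.top_mem x).2 hx.1
  refine ⟨fun i => ?_, fun i => ?_⟩
  · rw [innerCoords_apply]
    exact (hpos i).le
  · have hi : ∀ j, j ∈ supp α (⊤ : Submodule ℝ V) := fun j => by simp
    rw [innerCoords_apply, le_div_iff₀ (hw.pos ⊤ h.top_mem i (hi i)), ← hsum, mul_comm]
    exact Finset.single_le_sum (f := fun j => weight Φ α ε ⊤ j * ⟪x, α j⟫_ℝ)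
      (fun j hj => mul_nonneg (hw.pos ⊤ h.top_mem j hj).le (hpos j).le) (hi i)

lemma isNested_active (hΦ : IsRootSystem Φ) (hα : IsSimpleBasis Φ α)
    (hG : IsBuildingSet (rootLines Φ) G) (h : IsCoordBuilding α (fund α G))
    (hε : IsSuitable Φ α G ε) {x : V} (hx : x ∈ nestohedron Φ α G ε) :
    IsNested (fund α G)
      (active (fund α G) (piFunctional Φ α) (fun A => ε (Module.finrank ℝ A)) x) := by
  have hpos := inner_pos_of_mem_nestohedron hΦ hα hG h hε hx
  rw [nestohedron_eq_polyhedron] at hx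
  exact isNested_of_weightedSum_eq h (isDecreasingWeight_weight hΦ hα hG h hε) hpos
    (fun A hA => (two_pow_le_weightedSum_iff h hε hA x).2 (hx.2 A hA)) active_subset
    fun A hA => (weightedSum_eq_two_pow_iff h hε hA.1 x).2 hA.2

lemma exists_active_eq (hΦ : IsRootSystem Φ) (hα : IsSimpleBasis Φ α)
    (hG : IsBuildingSet (rootLines Φ) G) (h : IsCoordBuilding α (fund α G))
    (hε : IsSuitable Φ α G ε) {S : Set (Submodule ℝ V)} (hS : IsNested (fund α G) S)
    (htop : ⊤ ∈ S) : ∃ x ∈ nestohedron Φ α G ε,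
      active (fund α G) (piFunctional Φ α) (fun A => ε (Module.finrank ℝ A)) x = S := by
  obtain ⟨y, -, hy⟩ :=
    exists_weightedSum_eq_iff h (isDecreasingWeight_weight hΦ hα hG h hε) hS htop
  obtain ⟨x, hx⟩ := exists_inner_eq (α := α) y
  obtain rfl : (fun i => ⟪x, α i⟫_ℝ) = y := funext hx
  rw [nestohedron_eq_polyhedron]
  refine ⟨x, ⟨?_, fun A hA => ?_⟩, Set.ext fun A => ⟨fun hA => ?_, fun hA => ⟨hS.1 hA, ?_⟩⟩⟩
  · exact (weightedSum_eq_two_pow_iff h hε h.top_mem x).1 ((hy ⊤ h.top_mem).2.2 htop)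
  · exact (two_pow_le_weightedSum_iff h hε hA x).1 (hy A hA).1
  · exact (hy A hA.1).2.1 ((weightedSum_eq_two_pow_iff h hε hA.1 x).2 hA.2)
  · exact (weightedSum_eq_two_pow_iff h hε (hS.1 hA) x).1 ((hy A (hS.1 hA)).2.2 hA)

/-- A point whose active inequalities form a maximal nested set `S` is the vector `v_S`. -/
lemma isVertexVector_of_active (hΦ : IsRootSystem Φ) (hα : IsSimpleBasis Φ α)
    (hG : IsBuildingSet (rootLines Φ) G) (h : IsCoordBuilding α (fund α G))
    (hε : IsSuitable Φ α G ε) {S : Set (Submodule ℝ V)} (hS : IsMaximalNested (fund α G) S) {x : V}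
    (hx : x ∈ nestohedron Φ α G ε)
    (hxS : active (fund α G) (piFunctional Φ α) (fun A => ε (Module.finrank ℝ A)) x = S) :
    IsVertexVector Φ α G ε S x := by
  have htop := IsMaximalNested.top_mem h hS
  have hfin : S.Finite := h.finite.subset hS.prop.1
  have hzero : ∀ u : V, (∀ A ∈ S, ⟪deltaVec Φ α A, u⟫_ℝ = 0) → u = 0 := by
    intro u hu
    have hc := isCompact_nestohedron hΦ hα hG h hε
    have hx' := hx
    rw [nestohedron_eq_polyhedron] at hc hx'
    refine eq_zero_of_maximal_active h.finite h.top_mem hc hx' (fun z hz hxz => ?_) fun A hA => ?_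
    · rw [hxS] at hxz ⊢
      rw [← nestohedron_eq_polyhedron] at hz
      exact (hS.eq_of_subset (isNested_active hΦ hα hG h hε hz) hxz).symm
    · rw [hxS] at hA
      have h0 : ⟪delta Φ α, u⟫_ℝ = 0 := by rw [← deltaVec_top]; exact hu ⊤ htop
      rw [piFunctional_apply]
      by_cases hAt : A = ⊤
      · rw [hAt, piVec_top, h0]
      · have := hu A hA
        rw [deltaVec_of_ne hAt, inner_sub_left, h0] at this
        linarith
  have := hfin.fintype
  have hspan : ⊤ ≤ Submodule.span ℝ (Set.range fun A : S => deltaVec Φ α (A : Submodule ℝ V)) := by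
    rw [top_le_iff, ← Submodule.orthogonal_eq_bot_iff, Submodule.eq_bot_iff]
    intro u hu
    exact hzero u fun A hA => (Submodule.mem_orthogonal _ _).1 hu _
      (Submodule.subset_span ⟨⟨A, hA⟩, rfl⟩)
  have hVn : Module.finrank ℝ V = n := by
    rw [Module.finrank_eq_card_basis α, Fintype.card_fin]
  have hencard : S.encard = Fintype.card S := by
    rw [Set.encard_eq_coe_toFinset_card, Set.toFinset_card]
  -- A nested set has at most `n` members, and the `δ_A` span.
  have hcard : Fintype.card S = n := by
    refine le_antisymm ?_ ?_
    · have := h.encard_le hS.prop htop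
      rw [hencard] at this
      exact_mod_cast this
    · have := finrank_range_le_card (R := ℝ) (fun A : S => deltaVec Φ α (A : Submodule ℝ V))
      rwa [Set.finrank, top_le_iff.1 hspan, finrank_top, hVn] at this
  have hxH : ∀ A ∈ S, x ∈ hyperplane Φ α ε A := by
    intro A hA
    rw [← hxS] at hA
    rw [nestohedron_eq_polyhedron] at hx
    exact (mem_hyperplane_iff (mem_hyperplane_top.2 hx.1)).2 hA.2
  refine ⟨hS.prop.1, htop, by rw [hencard, hcard],
    linearIndependent_of_top_le_span_of_card_eq_finrank hspan (hcard.trans hVn.symm), ?_⟩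
  ext z
  rw [Set.mem_iInter₂, Set.mem_singleton_iff]
  refine ⟨fun hz => ?_, fun hz => hz ▸ hxH⟩
  refine sub_eq_zero.1 (hzero _ fun A hA => ?_)
  have h1 : ⟪z, deltaVec Φ α A⟫_ℝ = level n ε A := hz A hA
  have h2 : ⟪x, deltaVec Φ α A⟫_ℝ = level n ε A := hxH A hA
  rw [real_inner_comm, inner_sub_left, h1, h2, sub_self]

end Suitable

end Permutonestohedron

end

open Permutonestohedron in
theorem mainTheorem1 {V : Type*} [NormedAddCommGroup V] [InnerProductSpace ℝ V]
    [FiniteDimensional ℝ V] {n : ℕ} (Φ : Finset V) (hΦ : Permutonestohedron.IsRootSystem Φ)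
    (α : Module.Basis (Fin n) ℝ V) (hα : Permutonestohedron.IsSimpleBasis Φ α)
    (G : Set (Submodule ℝ V))
    (hG : Permutonestohedron.IsBuildingSet (Permutonestohedron.rootLines Φ) G)
    (hGV : (⊤ : Submodule ℝ V) ∈ G) (hGW : Permutonestohedron.IsInvariant Φ G)
    (ε : ℕ → ℝ) (hε : Permutonestohedron.IsSuitable Φ α G ε) :
    Permutonestohedron.IsNestohedron (Permutonestohedron.fund α G)
        (Permutonestohedron.nestohedron Φ α G ε) ∧
      Permutonestohedron.nestohedron Φ α G ε ⊆ Permutonestohedron.openChamber α ∧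
      (∀ S, Permutonestohedron.IsMaximalNested (Permutonestohedron.fund α G) S →
        ∃ x, Permutonestohedron.IsVertexVector Φ α G ε S x) ∧
      (Permutonestohedron.nestohedron Φ α G ε).extremePoints ℝ =
        {x | ∃ S, Permutonestohedron.IsMaximalNested (Permutonestohedron.fund α G) S ∧
          Permutonestohedron.IsVertexVector Φ α G ε S x} := by
  have h : IsCoordBuilding α (fund α G) := isCoordBuilding_fund hΦ hG hGV
  have hcomp := isCompact_nestohedron hΦ hα hG h hε
  have hnest := fun x => isNested_active hΦ hα hG h hε (x := x)
  have hex := fun S => exists_active_eq hΦ hα hG h hε (S := S)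
  have hvert := fun S => isVertexVector_of_active hΦ hα hG h hε (S := S)
  have hchamber := fun x => inner_pos_of_mem_nestohedron hΦ hα hG h hε (x := x)
  rw [nestohedron_eq_polyhedron] at *
  refine ⟨⟨isPolytope_polyhedron h.finite h.top_mem hcomp, ⟨facePosetIso h.finite h.top_mem _
    (fun x hx => ⟨hnest x hx, mem_active_top h.top_mem hx⟩) fun S hS => hex S hS.1 hS.2⟩⟩,
    fun x hx i => hchamber x hx i, fun S hS => ?_, Set.ext fun x => ⟨fun hx => ?_, ?_⟩⟩
  · obtain ⟨x, hx, hxS⟩ := hex S hS.prop (IsMaximalNested.top_mem h hS)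
    exact ⟨x, hvert S hS hx hxS⟩
  · have hmax : IsMaximalNested (fund α G) (active (fund α G) (piFunctional Φ α)
        (fun A => ε (Module.finrank ℝ A)) x) := by
      refine ⟨hnest x hx.1, fun T hT hxT => ?_⟩
      obtain ⟨z, hz, rfl⟩ := hex T hT (hxT (mem_active_top h.top_mem hx.1))
      rw [eq_of_mem_extremePoints h.finite h.top_mem hx hz hxT]
    exact ⟨_, hmax, hvert _ hmax hx.1 rfl⟩
  · rintro ⟨S, hS, hxS⟩
    obtain ⟨z, hz, rfl⟩ := hex S hS.prop hxS.top_mem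
    have huniq : ∀ w ∈ polyhedron (fund α G) ⊤ (piFunctional Φ α)
        (fun A => ε (Module.finrank ℝ A)), active (fund α G) (piFunctional Φ α)
          (fun A => ε (Module.finrank ℝ A)) z ⊆ active (fund α G) (piFunctional Φ α)
          (fun A => ε (Module.finrank ℝ A)) w → w = x := by
      intro w hw hzw
      have : w ∈ ⋂ A ∈ active (fund α G) (piFunctional Φ α)
          (fun A => ε (Module.finrank ℝ A)) z, hyperplane Φ α ε A :=
        Set.mem_iInter₂.2 fun A hA =>
          (mem_hyperplane_iff (mem_hyperplane_top.2 hw.1)).2 (hzw hA).2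
      rwa [hxS.inter_eq] at this
    obtain rfl := huniq z hz subset_rfl
    exact mem_extremePoints_of_active hz huniq
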